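/- Theorem (LP-Interpolation). Consider first-order logic without equality over a countable signature in which each predicate $p$ comes in two versions $p^0$ and $p^1$ of the same arity; formulas over this signature are called 0/1-superscripted. Semantic entailment $\models$ is over nonempty structures and all assignments of the free variables. For such a formula $F$ let: - $\mathrm{Fun}(F)$ be the set of functions (including constants) occurring in $F$; - $\mathrm{Pred}^{\pm}(F)$ be the set of pairs $+p^i$ ($-p^i$) such that $p^i$ occurs in $F$ with positive (negative) polarity; - $\mathsf{S}_F$ be the conjunction of $\forall \bar x\,(p^0(\bar x)\to p^1(\bar x))$ over all $p$ such that $p^0$ or $p^1$ occurs in $F$; - $\mathrm{rename}_{0\mapsto1}(F)$ be $F$ with each $p^0$ replaced by $p^1$. $F$ is universal if $\forall$ occurs in it only with positive and $\exists$ only with negative polarity; $F$ encodes a logic program if $F$ is universal and $\mathsf{S}_F\wedge F\models \mathrm{rename}_{0\mapsto1}(F)$. A formula $H'$ is called here a Craig-Lyndon interpolant of $A$ and $B$ if $A\models H'$, $H'\models B$, $\mathrm{Pred}^{\pm}(H')\subseteq \mathrm{Pred}^{\pm}(A)\cap \mathrm{Pred}^{\pm}(B)$ and $\mathrm{Fun}(H')\subseteq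 \mathrm{Fun}(A)\cap \mathrm{Fun}(B)$ (free variables are treated separately). Let $F$ be a 0/1-superscripted formula that encodes a logic program and let $G$ be a 0/1-superscripted formula such that $\mathrm{Fun}(F)\subseteq \mathrm{Fun}(G)$ and $\mathsf{S}_F\wedge F\models \mathsf{S}_G\to G$. Call a 0/1-superscripted formula $H$ an LP-interpolant of $F$ and $G$ if 1. $\mathsf{S}_F\wedge F\models H$; 2. $H\models \mathsf{S}_G\to G$; 3. $\mathrm{Pred}^{\pm}(H)\subseteq S\cup\{+p^1\mid +p^0\in S\}\cup\{-p^1\mid -p^0\in S\}$, where $S=\mathrm{Pred}^{\pm}(\mathsf{S}_F\wedge F)\cap \mathrm{Pred}^{\pm}(\mathsf{S}_G\to G)$; 4. $\mathrm{Fun}(H)\subseteq \mathrm{Fun}(F)$; 5. $H$ encodes a logic program. Then an LP-interpolant of $F$ and $G$ exists. Moreover, it can be effectively constructed via a universal Craig-Lyndon interpolant: there is a partial recursive function on Gödel numbers of formulas, not depending on $F$ and $G$, which for all $F,G$ as above terminates and outputs (the Gödel number of) an LP-interpolant $H=H'\wedge \mathrm{rename}_{0\mapsto1}(H')$, where $H'$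 is a universal Craig-Lyndon interpolant of $\mathsf{S}_F\wedge F$ and $\mathsf{S}_G\to G$ whose free variables all occur free in $F$. Furthermore, for every universal Craig-Lyndon interpolant $H'$ of $\mathsf{S}_F\wedge F$ and $\mathsf{S}_G\to G$, the formula $H'\wedge \mathrm{rename}_{0\mapsto1}(H')$ is an LP-interpolant of $F$ and $G$. -/

import Mathlib

open FirstOrder

universe u v w

namespace LPInterpolation

/-! ### Formulas: vocabulary, polarity, entailment -/

section General

variable {L : FirstOrder.Language.{u, v}} {α : Type w}

/-- The formula is a formula of first-order logic without equality. -/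
def EqFree : ∀ {n : ℕ}, L.BoundedFormula α n → Prop
  | _, .falsum => True
  | _, .equal _ _ => False
  | _, .rel _ _ => True
  | _, .imp f g => EqFree f ∧ EqFree g
  | _, .all f => EqFree f

/-- The functions (including constants), with their arity, that occur in a term. -/
def termFun {β : Type w} : L.Term β → Set (Σ k, L.Functions k)
  | .var _ => ∅
  | .func f ts => {⟨_, f⟩} ∪ ⋃ i, termFun (ts i)

/-- `Fun(F)`: the functions (including constants), with their arity, that occur in a formula. -/
def Fun : ∀ {n : ℕ}, L.BoundedFormula α n → Set (Σ k, L.Functions k)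
  | _, .falsum => ∅
  | _, .equal t s => termFun t ∪ termFun s
  | _, .rel _ ts => ⋃ i, termFun (ts i)
  | _, .imp f g => Fun f ∪ Fun g
  | _, .all f => Fun f

/-- The polarity/predicate pairs of a formula that itself occurs with polarity `s`
(`true` for positive, `false` for negative). The left side of an implication is an implicitly
negated occurrence; the other connectives are defined from `⊥`, implication and `∀`. -/
def predPolAux : ∀ {n : ℕ}, Bool → L.BoundedFormula α n → Set (Bool × Σ k, L.Relations k)
  | _, _, .falsum => ∅
  | _, _, .equal _ _ => ∅
  | _, s, .rel R _ => {(s, ⟨_, R⟩)}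
  | _, s, .imp f g => predPolAux (!s) f ∪ predPolAux s g
  | _, s, .all f => predPolAux s f

/-- `Pred^±(F)`, the set of polarity/predicate pairs of `F`. -/
def PredPol (F : L.Formula α) : Set (Bool × Σ k, L.Relations k) := predPolAux true F

/-- A formula that itself occurs with polarity `s` has all its occurrences of `∀` with positive
polarity. Since `∃ x, f` is `¬ ∀ x, ¬ f`, an occurrence of `∃` with positive (negative) polarity is
an occurrence of `∀` with negative (positive) polarity. -/
def univAux : ∀ {n : ℕ}, Bool → L.BoundedFormula α n → Prop
  | _, _, .falsum => True
  | _, _, .equal _ _ => True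
  | _, _, .rel _ _ => True
  | _, s, .imp f g => univAux (!s) f ∧ univAux s g
  | _, s, .all f => s = true ∧ univAux s f

/-- `F` is universal: occurrences of `∀` have only positive and occurrences of `∃` have only
negative polarity. (Not restricted to prenex formulas.) -/
def Universal (F : L.Formula α) : Prop := univAux true F

/-- Semantic entailment: in every (nonempty) structure, every assignment of the free variables that
satisfies `F` satisfies `G`. -/
def Entails (F G : L.Formula α) : Prop := (∅ : L.Theory) ⊨ᵇ F.imp G

/-- `H` is a Craig-Lyndon interpolant of `A` and `B`. The condition on the free variables of `H`
(which is void for sentences) is not included and is stated separately where it is needed. -/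
structure IsCraigLyndonInterpolant (A B H : L.Formula α) : Prop where
  eqFree : EqFree H
  left : Entails A H
  right : Entails H B
  predPol : PredPol H ⊆ PredPol A ∩ PredPol B
  func : Fun H ⊆ Fun A ∩ Fun B

end General

/-! ### 0/1-superscripted formulas -/

/-- The language for 0/1-superscripted formulas: for each predicate `p` of `L` there are the two
predicates `p⁰ = (p, 0)` and `p¹ = (p, 1)` with the same arity; functions are unchanged. -/
abbrev zeroOne (L : FirstOrder.Language.{u, v}) : FirstOrder.Language.{u, v} where
  Functions := L.Functions
  Relations := fun k => L.Relations k × Fin 2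

section ZeroOne

variable {L : FirstOrder.Language.{u, v}} {α : Type w}

/-- The replacement of `p⁰` by `p¹`, as a map of languages. -/
def renameHom (L : FirstOrder.Language.{u, v}) : zeroOne L →ᴸ zeroOne L where
  onFunction := fun _ f => f
  onRelation := fun _ R => (R.1, 1)

/-- `rename_{0 ↦ 1}(F)`. -/
def rename01 (F : (zeroOne L).Formula α) : (zeroOne L).Formula α := (renameHom L).onFormula F

/-- A list of the elements of `Pred^LP(F) = {p | p⁰ or p¹ occurs in F}`, possibly with
repetitions. -/
def predLP : ∀ {n : ℕ}, (zeroOne L).BoundedFormula α n → List (Σ k, L.Relations k)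
  | _, .falsum => []
  | _, .equal _ _ => []
  | _, .rel R _ => [⟨_, R.1⟩]
  | _, .imp f g => predLP f ++ predLP g
  | _, .all f => predLP f

/-- The formula `∀ x₁ … xₖ, p⁰(x₁, …, xₖ) → p¹(x₁, …, xₖ)`. -/
def zeroImpOne (p : Σ k, L.Relations k) : (zeroOne L).Formula α :=
  (((Language.Relations.boundedFormula (L := zeroOne L) (p.2, (0 : Fin 2))
      fun i : Fin p.1 => Language.Term.var (Sum.inr i)).imp
    (Language.Relations.boundedFormula (L := zeroOne L) (p.2, (1 : Fin 2))
      fun i : Fin p.1 => Language.Term.var (Sum.inr i))).alls)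

/-- `S_F`, the conjunction of `∀ x, p⁰(x) → p¹(x)` over all `p` in `Pred^LP(F)`. -/
def S (F : (zeroOne L).Formula α) : (zeroOne L).Formula α :=
  (predLP F).foldr (fun p K => zeroImpOne p ⊓ K) ⊤

/-- `F` encodes a logic program. -/
def EncodesLP (F : (zeroOne L).Formula α) : Prop :=
  Universal F ∧ Entails (S F ⊓ F) (rename01 F)

/-- The common polarity/predicate pairs of `S_F ∧ F` and `S_G → G`. -/
def commonPred (F G : (zeroOne L).Formula α) : Set (Bool × Σ k, (zeroOne L).Relations k) :=
  PredPol (S F ⊓ F) ∩ PredPol ((S G).imp G)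

/-- The polarity/predicate pairs `± p¹` such that `± p⁰` is in `V`. -/
def oneCopies (V : Set (Bool × Σ k, (zeroOne L).Relations k)) :
    Set (Bool × Σ k, (zeroOne L).Relations k) :=
  {x | ∃ (s : Bool) (k : ℕ) (p : L.Relations k),
    (s, ⟨k, (p, (0 : Fin 2))⟩) ∈ V ∧ x = (s, ⟨k, (p, (1 : Fin 2))⟩)}

/-- `H` is an LP-interpolant of `F` and `G`. -/
structure IsLPInterpolant (F G H : (zeroOne L).Formula α) : Prop where
  eqFree : EqFree H
  left : Entails (S F ⊓ F) H
  right : Entails H ((S G).imp G)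
  predPol : PredPol H ⊆ commonPred F G ∪ oneCopies (commonPred F G)
  func : Fun H ⊆ Fun F
  encodes : EncodesLP H

end ZeroOne

/-! ### Gödel numbers -/

section Code

variable {L : FirstOrder.Language.{u, v}} {α : Type w} [∀ k, Encodable (L.Functions k)]
  [Encodable α]

/-- Gödel number of a term with free variables in `α` and bound variables in `Fin n`. -/
def termCode {n : ℕ} : (zeroOne L).Term (α ⊕ Fin n) → ℕ
  | .var (.inl x) => Nat.pair 0 (Encodable.encode x)
  | .var (.inr i) => Nat.pair 1 i
  | .func (l := l) f ts =>
    Nat.pair 2 (Nat.pair l (Nat.pair (Encodable.encode (α := L.Functions l) f)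
      (Encodable.encode (List.ofFn fun i => termCode (ts i)))))

theorem termCode_injective {n : ℕ} (t s : (zeroOne L).Term (α ⊕ Fin n))
    (h : termCode t = termCode s) : t = s := by
  induction t generalizing s with
  | var x =>
    rcases x with x | x <;> rcases s with (y | y) | ⟨f, ts⟩ <;>
      simp only [termCode, Nat.pair_eq_pair] at h
    · rw [Encodable.encode_injective h.2]
    · omega
    · omega
    · omega
    · rw [Fin.ext h.2]
    · omega
  | func f ts ih =>
    rcases s with (y | y) | ⟨g, ss⟩ <;> simp only [termCode, Nat.pair_eq_pair] at h
    · omega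
    · omega
    · obtain ⟨-, rfl, hf, hl⟩ := h
      have hts := List.ofFn_injective (Encodable.encode_injective hl)
      rw [Encodable.encode_injective hf]
      congr 1
      funext i
      exact ih i _ (congrFun hts i)

variable [∀ k, Encodable (L.Relations k)]

/-- Gödel number of a formula. -/
def code : ∀ {n : ℕ}, (zeroOne L).BoundedFormula α n → ℕ
  | _, .falsum => Nat.pair 0 0
  | _, .equal t s => Nat.pair 1 (Nat.pair (termCode t) (termCode s))
  | _, .rel (l := l) R ts =>
    Nat.pair 2 (Nat.pair l (Nat.pair
      (Nat.pair (Encodable.encode (α := L.Relations l) R.1) R.2)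
      (Encodable.encode (List.ofFn fun i => termCode (ts i)))))
  | _, .imp f g => Nat.pair 3 (Nat.pair (code f) (code g))
  | _, .all f => Nat.pair 4 (code f)

/-- Distinct formulas have distinct Gödel numbers. -/
theorem code_injective {n : ℕ} (F G : (zeroOne L).BoundedFormula α n)
    (h : code F = code G) : F = G := by
  induction F with
  | falsum =>
    cases G <;> simp only [code, Nat.pair_eq_pair] at h <;> first | rfl | omega
  | equal t s =>
    cases G <;> simp only [code, Nat.pair_eq_pair] at h <;> try omega
    rw [termCode_injective _ _ h.2.1, termCode_injective _ _ h.2.2]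
  | rel R ts =>
    cases G <;> simp only [code, Nat.pair_eq_pair] at h <;> try omega
    obtain ⟨-, rfl, ⟨h1, h2⟩, hl⟩ := h
    have hts := List.ofFn_injective (Encodable.encode_injective hl)
    rw [Prod.ext (Encodable.encode_injective h1) (Fin.ext h2)]
    congr 1
    funext i
    exact termCode_injective _ _ (congrFun hts i)
  | imp f g ihf ihg =>
    cases G <;> simp only [code, Nat.pair_eq_pair] at h <;> try omega
    rw [ihf _ h.2.1, ihg _ h.2.2]
  | all f ih =>
    cases G <;> simp only [code, Nat.pair_eq_pair] at h <;> try omega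
    rw [ih _ h.2]

end Code

end LPInterpolation

open LPInterpolation

namespace LPInterpolation

/-! ### Propositional clause sets

A literal is a pair of a propositional variable and a sign; a clause is a list of literals. -/

/-! Write A for `S F ⊓ F` and B for `(S G).imp G`.

From a universal Craig-Lyndon interpolant H' to an LP-interpolant (`isLPInterpolant_inf_rename01`):
renaming 0 to 1 amounts to evaluating the formula in the structure where p⁰ is read as p¹. If a
structure satisfies A, then this reinterpretation satisfies F, because F encodes a logic program,
and it satisfies `S F` trivially. So it satisfies A, hence H', and the original structure satisfies
`rename01 H'`. Renaming is idempotent and preserves polarities, functions and universality, which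
settles the other conditions.

Existence of H' (`exists_universal_interpolant`) is model-theoretic and uses that A is universal
with all its functions occurring in B. If the universal consequences of A in the common vocabulary
did not entail B, compactness would give a structure N that satisfies them all and falsifies B.
Consider the literals true in N that the common signed predicates allow, with the terms foreign to A
replaced by names. No finite set of them contradicts A: otherwise quantifying the names universally
would yield a universal consequence of A that fails in N. By compactness A and all these literals
have a model M. The terms over N then carry a structure with a map to M that pulls A back (A is
universal) and a surjection onto N that would push B forward (`not_entails_of_diagram`), so A would
not entail B.

Effectiveness: an equality-free formula is falsifiable exactly if a primitive recursive sequence of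
propositional Henkin clauses is satisfiable, and by propositional compactness unsatisfiability has a
finite, checkable certificate (`entails_iff_exists_unsatCert`). Well-formedness, universality and
the vocabulary conditions are primitive recursive in the code (`primrecPred_admissible`,
`admissible_code_iff`). An unbounded search for a code together with certificates for both
entailments is therefore partial recursive. The existence theorem makes it stop, and the
certificates make its output correct. -/

/-- The valuation `x` satisfies the clause `c`. -/
def SatClause (x : ℕ → Bool) (c : List (ℕ × Bool)) : Prop := ∃ p ∈ c, x p.1 = p.2

/-- `N` is a certificate for the unsatisfiability of the clauses `cl 0, cl 1, …`: every valuation of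
the variables below `N` falsifies one of the clauses `cl j`, `j < N`, over these variables. -/
def UnsatCert (cl : ℕ → List (ℕ × Bool)) (N : ℕ) : Prop :=
  ∀ x < 2 ^ N, ∃ j < N, ∀ p ∈ cl j, p.1 < N ∧ (x.testBit p.1) ≠ p.2

/-- Compactness of propositional logic. If there is no certificate, then for each N some valuation
satisfies every clause with index below N whose variables are below N; a limit of these valuations
along a nonprincipal ultrafilter satisfies all clauses, since each clause is finite. -/
theorem exists_unsatCert_iff (cl : ℕ → List (ℕ × Bool)) :
    (∃ N, UnsatCert cl N) ↔ ¬ ∃ x : ℕ → Bool, ∀ j, SatClause x (cl j) := by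
  constructor
  · rintro ⟨N, hN⟩ ⟨x, hx⟩
    obtain ⟨j, -, h⟩ := hN (Nat.ofBits fun i : Fin N => x i) (Nat.ofBits_lt_two_pow _)
    obtain ⟨p, hp, hxp⟩ := hx j
    obtain ⟨h1, h2⟩ := h p hp
    rw [Nat.testBit_ofBits_lt _ _ h1] at h2
    exact h2 hxp
  · intro h
    by_contra! hN
    simp only [UnsatCert, not_forall] at hN
    choose y _ hy using hN
    push Not at hy
    classical
    apply h
    -- The ultrafilter limit. If it falsified clause j, then almost all `y N` would falsify all
    -- literals of that clause, and some such N exceeds j and the variables of the clause.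
    refine ⟨fun n => decide (∀ᶠ N in (Filter.hyperfilter ℕ : Filter ℕ), (y N).testBit n = true),
      fun j => ?_⟩
    by_contra hj
    simp only [SatClause, not_exists, not_and] at hj
    have h1 : ∀ᶠ N in (Filter.hyperfilter ℕ : Filter ℕ), ∀ p ∈ {p | p ∈ cl j},
        p.1 < N ∧ (y N).testBit p.1 ≠ p.2 := by
      rw [Filter.eventually_all_finite (List.finite_toSet _)]
      intro p hp
      have hat : ∀ᶠ N in (Filter.hyperfilter ℕ : Filter ℕ), p.1 < N :=
        (Nat.hyperfilter_le_atTop) (Filter.eventually_gt_atTop p.1)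
      refine hat.and ?_
      have := hj p hp
      rcases p with ⟨n, b⟩
      cases b
      · simpa using this
      · simp only [decide_eq_true_eq, ← Ultrafilter.eventually_not] at this
        exact this
    have h2 : ∀ᶠ N in (Filter.hyperfilter ℕ : Filter ℕ), j < N :=
      (Nat.hyperfilter_le_atTop) (Filter.eventually_gt_atTop j)
    obtain ⟨N, hN1, hN2⟩ := (h1.and h2).exists
    obtain ⟨p, hp, h3⟩ := hy N j hN2
    obtain ⟨h4, h5⟩ := hN1 p hp
    exact h5 (h3 h4)

theorem primrec_testBit : Primrec₂ Nat.testBit := by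
  have hpow : Primrec₂ ((· ^ ·) : ℕ → ℕ → ℕ) := Primrec₂.unpaired'.1 Nat.Primrec.pow
  have : PrimrecRel fun x n : ℕ => x / 2 ^ n % 2 = 1 :=
    Primrec.eq.comp (Primrec.nat_mod.comp (Primrec.nat_div.comp Primrec.fst
      (hpow.comp (.const 2) Primrec.snd)) (.const 2)) (.const 1)
  refine (this.decide).of_eq fun x n => ?_
  rw [Nat.testBit_eq_decide_div_mod_eq]

theorem primrecPred_unsatCert {β : Type*} [Primcodable β] {cl : β → ℕ → List (ℕ × Bool)}
    (hcl : Primrec₂ cl) : PrimrecPred fun p : β × ℕ => UnsatCert (cl p.1) p.2 := by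
  have h1 : PrimrecRel fun (p : ℕ × Bool) (q : ℕ × ℕ) => p.1 < q.1 ∧ q.2.testBit p.1 ≠ p.2 := by
    refine PrimrecPred.and (Primrec.nat_lt.comp (Primrec.fst.comp Primrec.fst)
      (Primrec.fst.comp Primrec.snd)) (PrimrecPred.not (Primrec.eq.comp
        (primrec_testBit.comp (Primrec.snd.comp Primrec.snd) (Primrec.fst.comp Primrec.fst))
        (Primrec.snd.comp Primrec.fst)))
  have h2 : PrimrecRel fun (j : ℕ) (q : β × ℕ × ℕ) =>
      ∀ p ∈ cl q.1 j, p.1 < q.2.1 ∧ q.2.2.testBit p.1 ≠ p.2 :=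
    h1.forall_mem_list.comp (hcl.comp (Primrec.fst.comp Primrec.snd) Primrec.fst)
      (Primrec.snd.comp Primrec.snd)
  have h3 : PrimrecRel fun (x : ℕ) (q : β × ℕ) => ∃ j ∈ List.range q.2,
      ∀ p ∈ cl q.1 j, p.1 < q.2 ∧ x.testBit p.1 ≠ p.2 :=
    (h2.exists_mem_list).comp (Primrec.list_range.comp (Primrec.snd.comp Primrec.snd))
      (.pair (Primrec.fst.comp Primrec.snd) (.pair (Primrec.snd.comp Primrec.snd) Primrec.fst))
  have hpow : Primrec₂ ((· ^ ·) : ℕ → ℕ → ℕ) := Primrec₂.unpaired'.1 Nat.Primrec.pow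
  have h4 : PrimrecPred fun q : β × ℕ => ∀ x ∈ List.range (2 ^ q.2), ∃ j ∈ List.range q.2,
      ∀ p ∈ cl q.1 j, p.1 < q.2 ∧ x.testBit p.1 ≠ p.2 :=
    (h3.forall_mem_list).comp (Primrec.list_range.comp (hpow.comp (.const 2) Primrec.snd))
      Primrec.id
  exact h4.of_eq fun q => by simp [UnsatCert]

end LPInterpolation

namespace LPInterpolation

/-! ### Gödel numbers as syntax -/

/-- The list of numbers with a given code. -/
def codeList (n : ℕ) : List ℕ := Denumerable.ofNat (List ℕ) n

@[simp] theorem codeList_encode (l : List ℕ) : codeList (Encodable.encode l) = l :=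
  Denumerable.ofNat_encode l

@[simp] theorem encode_codeList (n : ℕ) : Encodable.encode (codeList n) = n :=
  Denumerable.encode_ofNat n

theorem mem_lt_encode {l : List ℕ} {x : ℕ} (h : x ∈ l) : x < Encodable.encode l := by
  induction l with
  | nil => simp at h
  | cons a l ih =>
    rw [Encodable.encode_list_cons, Nat.lt_succ_iff]
    rcases List.mem_cons.1 h with rfl | h
    · exact Nat.left_le_pair _ _
    · exact (ih h).le.trans (Nat.right_le_pair _ _)

theorem mem_codeList_lt {n x : ℕ} (h : x ∈ codeList n) : x < n := by
  simpa using mem_lt_encode h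

theorem primrec_codeList : Primrec codeList := Primrec.ofNat _

/-- The arguments of a term code. -/
def termArgs (t : ℕ) : List ℕ := codeList t.unpair.2.unpair.2.unpair.2

theorem mem_termArgs_lt {t s : ℕ} (h : s ∈ termArgs t) : s < t :=
  (mem_codeList_lt h).trans_le ((Nat.unpair_right_le _).trans ((Nat.unpair_right_le _).trans
    (Nat.unpair_right_le _)))

/-- The basis of every recursion on formula codes. A nonzero tag is needed: `Nat.pair 0 0 = 0` and
`Nat.pair 0 1 = 1`. -/
theorem unpair_snd_lt {n : ℕ} (h : n.unpair.1 ≠ 0) : n.unpair.2 < n := by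
  conv_rhs => rw [← Nat.pair_unpair n]
  generalize n.unpair.1 = a at *
  generalize n.unpair.2 = b
  unfold Nat.pair
  split_ifs
  · have := Nat.le_mul_self b
    omega
  · have : 1 ≤ a := by omega
    nlinarith

theorem left_lt {n : ℕ} (h : n.unpair.1 ≠ 0) : n.unpair.2.unpair.1 < n :=
  (Nat.unpair_left_le _).trans_lt (unpair_snd_lt h)

theorem right_lt {n : ℕ} (h : n.unpair.1 ≠ 0) : n.unpair.2.unpair.2 < n :=
  (Nat.unpair_right_le _).trans_lt (unpair_snd_lt h)

/-- Substitution of `e` for the bound variables in a term code. -/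
def subst (e : List ℕ) (t : ℕ) : ℕ :=
  if t.unpair.1 = 0 then t
  -- The default 0 is itself the code of a free variable; `groundVal` sends it to `fv 0`, which is
  -- the default in `termVal`. Entries of `e` are closed and are not substituted into again.
  else if t.unpair.1 = 1 then e.getD t.unpair.2 0
  else if t.unpair.1 = 2 then
    Nat.pair 2 (Nat.pair t.unpair.2.unpair.1 (Nat.pair t.unpair.2.unpair.2.unpair.1
      (Encodable.encode ((termArgs t).attach.map fun s => subst e s.1))))
  else 0
termination_by t
decreasing_by exact mem_termArgs_lt s.2

theorem subst_eq (e : List ℕ) (t : ℕ) : subst e t =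
    if t.unpair.1 = 0 then t
    else if t.unpair.1 = 1 then e.getD t.unpair.2 0
    else if t.unpair.1 = 2 then
      Nat.pair 2 (Nat.pair t.unpair.2.unpair.1 (Nat.pair t.unpair.2.unpair.2.unpair.1
        (Encodable.encode ((termArgs t).map fun s => subst e s))))
    else 0 := by
  rw [subst, List.attach_map_val (f := fun s => subst e s)]

/-- The code of the atom that results from an atom code by substitution of `e`. -/
def substAtom (e : List ℕ) (a : ℕ) : ℕ :=
  Nat.pair a.unpair.1 (Nat.pair a.unpair.2.unpair.1
    (Encodable.encode ((codeList a.unpair.2.unpair.2).map fun s => subst e s)))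

/-- The propositional variable for a formula code under an assignment of the bound variables. -/
def formulaVar (e : List ℕ) (a : ℕ) : ℕ := Nat.pair 0 (Nat.pair (Encodable.encode e) a)

/-- The propositional variable for a ground atom. -/
def atomVar (a : ℕ) : ℕ := Nat.pair 1 a

/-- The Henkin witness for a code of a formula that is not true universally. -/
def witness (e : List ℕ) (a : ℕ) : ℕ := Nat.pair 3 (Nat.pair (Encodable.encode e) a)

/-- The clauses stating that a valuation respects the connectives and quantifiers and falsifies
the formula with code `φ`. -/
def henkinClauses (φ : ℕ) (e : List ℕ) (a b : ℕ) : List (List (ℕ × Bool)) :=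
  [ [(formulaVar [] φ, false)],
   [(formulaVar e 0, false)],
   [(formulaVar e (Nat.pair 3 (Nat.pair a b)), true), (formulaVar e a, true)],
   [(formulaVar e (Nat.pair 3 (Nat.pair a b)), true), (formulaVar e b, false)],
   [(formulaVar e (Nat.pair 3 (Nat.pair a b)), false), (formulaVar e a, false),
    (formulaVar e b, true)],
   -- Here `b` is an arbitrary number used as an element of the domain. The next clause is the
   -- Henkin axiom: if the universal formula is false, so is its instance at the witness.
   [(formulaVar e (Nat.pair 4 a), false), (formulaVar (e ++ [b]) a, true)],
   [(formulaVar e (Nat.pair 4 a), true), (formulaVar (e ++ [witness e a]) a, false)],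
   [(formulaVar e (Nat.pair 2 a), true), (atomVar (substAtom e a), false)],
   [(formulaVar e (Nat.pair 2 a), false), (atomVar (substAtom e a), true)] ]

/-- The enumeration of all Henkin clauses. -/
def henkinClause (φ j : ℕ) : List (ℕ × Bool) :=
  -- The default repeats a clause of the list, so surplus indices impose nothing new.
  (henkinClauses φ (codeList j.unpair.2.unpair.1) j.unpair.2.unpair.2.unpair.1
    j.unpair.2.unpair.2.unpair.2).getD j.unpair.1 [(formulaVar [] φ, false)]

theorem forall_henkinClause {φ : ℕ} {P : List (ℕ × Bool) → Prop} :
    (∀ j, P (henkinClause φ j)) ↔ ∀ e a b, ∀ c ∈ henkinClauses φ e a b, P c := by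
  constructor
  · intro h e a b c hc
    obtain ⟨k, hk, rfl⟩ := List.mem_iff_getElem.1 hc
    have := h (Nat.pair k (Nat.pair (Encodable.encode e) (Nat.pair a b)))
    simpa [henkinClause, hk] using this
  · intro h j
    unfold henkinClause
    generalize codeList j.unpair.2.unpair.1 = e
    generalize j.unpair.2.unpair.2.unpair.1 = a
    generalize j.unpair.2.unpair.2.unpair.2 = b
    by_cases hk : j.unpair.1 < (henkinClauses φ e a b).length
    · rw [List.getD_eq_getElem _ _ hk]
      exact h e a b _ (List.getElem_mem hk)
    · rw [List.getD_eq_default _ _ (not_lt.1 hk)]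
      exact h e a b _ (by simp [henkinClauses])

/-! ### Primitive recursiveness of the Henkin clauses -/

theorem primrec_unpair_fst : Primrec fun n : ℕ => n.unpair.1 := Primrec.fst.comp Primrec.unpair

theorem primrec_unpair_snd : Primrec fun n : ℕ => n.unpair.2 := Primrec.snd.comp Primrec.unpair

theorem primrec_termArgs : Primrec termArgs :=
  primrec_codeList.comp (primrec_unpair_snd.comp (primrec_unpair_snd.comp primrec_unpair_snd))

/-- Course-of-values recursion: the arguments of a term have smaller codes than the term. -/
theorem primrec_subst : Primrec₂ subst := by
  refine Primrec.nat_omega_rec subst (m := fun _ t => t) (l := fun _ t => termArgs t)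
    (g := fun e p => some (
      if p.1.unpair.1 = 0 then p.1
      else if p.1.unpair.1 = 1 then e.getD p.1.unpair.2 0
      else if p.1.unpair.1 = 2 then
        Nat.pair 2 (Nat.pair p.1.unpair.2.unpair.1 (Nat.pair p.1.unpair.2.unpair.2.unpair.1
          (Encodable.encode p.2)))
      else 0)) Primrec₂.right (primrec_termArgs.comp₂ Primrec₂.right) ?_
      (fun _ _ _ h => mem_termArgs_lt h) (fun e t => by rw [← subst_eq])
  have ht : Primrec fun q : List ℕ × ℕ × List ℕ => q.2.1 := Primrec.fst.comp Primrec.snd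
  have htag := primrec_unpair_fst.comp ht
  have harg := primrec_unpair_snd.comp ht
  refine Primrec.option_some.comp (.ite (Primrec.eq.comp htag (.const 0)) ht
    (.ite (Primrec.eq.comp htag (.const 1)) ((Primrec.list_getD 0).comp Primrec.fst harg)
    (.ite (Primrec.eq.comp htag (.const 2)) ?_ (.const 0))))
  exact Primrec₂.natPair.comp (.const 2) (Primrec₂.natPair.comp (primrec_unpair_fst.comp harg)
    (Primrec₂.natPair.comp (primrec_unpair_fst.comp (primrec_unpair_snd.comp harg))
      (Primrec.encode.comp (Primrec.snd.comp Primrec.snd))))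

theorem primrec_substAtom : Primrec₂ substAtom := by
  have ha : Primrec fun q : List ℕ × ℕ => q.2.unpair.1 := primrec_unpair_fst.comp Primrec.snd
  have hb : Primrec fun q : List ℕ × ℕ => q.2.unpair.2 := primrec_unpair_snd.comp Primrec.snd
  exact Primrec₂.natPair.comp ha (Primrec₂.natPair.comp (primrec_unpair_fst.comp hb)
    (Primrec.encode.comp (Primrec.list_map
      (primrec_codeList.comp (primrec_unpair_snd.comp hb))
      (primrec_subst.comp (Primrec.fst.comp Primrec.fst) Primrec.snd))))

theorem primrec_formulaVar : Primrec₂ formulaVar :=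
  Primrec₂.natPair.comp (.const 0) (Primrec₂.natPair.comp
    (Primrec.encode.comp Primrec.fst) Primrec.snd)

theorem primrec_witness : Primrec₂ witness :=
  Primrec₂.natPair.comp (.const 3) (Primrec₂.natPair.comp
    (Primrec.encode.comp Primrec.fst) Primrec.snd)

theorem primrec_henkinClause : Primrec₂ henkinClause := by
  have hφ : Primrec fun q : ℕ × ℕ => q.1 := Primrec.fst
  have hk : Primrec fun q : ℕ × ℕ => q.2.unpair.1 := primrec_unpair_fst.comp Primrec.snd
  have hr : Primrec fun q : ℕ × ℕ => q.2.unpair.2 := primrec_unpair_snd.comp Primrec.snd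
  have he : Primrec fun q : ℕ × ℕ => codeList q.2.unpair.2.unpair.1 :=
    primrec_codeList.comp (primrec_unpair_fst.comp hr)
  have ha : Primrec fun q : ℕ × ℕ => q.2.unpair.2.unpair.2.unpair.1 :=
    primrec_unpair_fst.comp (primrec_unpair_snd.comp hr)
  have hb : Primrec fun q : ℕ × ℕ => q.2.unpair.2.unpair.2.unpair.2 :=
    primrec_unpair_snd.comp (primrec_unpair_snd.comp hr)
  have hstart := primrec_formulaVar.comp (.const []) hφ
  have himp := primrec_formulaVar.comp he (Primrec₂.natPair.comp (.const 3)
    (Primrec₂.natPair.comp ha hb))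
  have hfa := primrec_formulaVar.comp he ha
  have hfb := primrec_formulaVar.comp he hb
  have hall := primrec_formulaVar.comp he (Primrec₂.natPair.comp (.const 4) ha)
  have hrel := primrec_formulaVar.comp he (Primrec₂.natPair.comp (.const 2) ha)
  have hatom := Primrec₂.natPair.comp (.const 1) (primrec_substAtom.comp he ha)
  have hinst := primrec_formulaVar.comp (Primrec.list_concat.comp he hb) ha
  have hwit := primrec_formulaVar.comp (Primrec.list_concat.comp he (primrec_witness.comp he ha)) ha
  have hlit : ∀ {f : ℕ × ℕ → ℕ} (s : Bool), Primrec f → Primrec fun q => (f q, s) :=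
    fun s hf => hf.pair (.const s)
  have hcons : ∀ {σ : Type} [Primcodable σ] {f : ℕ × ℕ → σ} {g : ℕ × ℕ → List σ},
      Primrec f → Primrec g → Primrec fun q => f q :: g q :=
    fun hf hg => Primrec.list_cons.comp hf hg
  have h0 := hcons (hlit false hstart) (.const [])
  have hcl : Primrec fun q : ℕ × ℕ => henkinClauses q.1 (codeList q.2.unpair.2.unpair.1)
      q.2.unpair.2.unpair.2.unpair.1 q.2.unpair.2.unpair.2.unpair.2 :=
    hcons h0 <|
    hcons (hcons (hlit false (primrec_formulaVar.comp he (.const 0))) (.const [])) <|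
    hcons (hcons (hlit true himp) (hcons (hlit true hfa) (.const []))) <|
    hcons (hcons (hlit true himp) (hcons (hlit false hfb) (.const []))) <|
    hcons (hcons (hlit false himp) (hcons (hlit false hfa) (hcons (hlit true hfb) (.const [])))) <|
    hcons (hcons (hlit false hall) (hcons (hlit true hinst) (.const []))) <|
    hcons (hcons (hlit true hall) (hcons (hlit false hwit) (.const []))) <|
    hcons (hcons (hlit true hrel) (hcons (hlit false hatom) (.const []))) <|
    hcons (hcons (hlit false hrel) (hcons (hlit true hatom) (.const []))) (.const [])
  refine (Primrec.option_getD.comp (Primrec.list_getElem?.comp hcl hk) h0).to₂.of_eq fun φ j => ?_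
  rw [henkinClause, List.getD_eq_getElem?_getD]

end LPInterpolation

namespace LPInterpolation

/-! ### Semantics of Gödel numbers -/

section NumberSemantics

variable {M : Type*} (fn : ℕ → ℕ → List M → M) (rl : ℕ → ℕ → List M → Prop) (fv : ℕ → M)

/-- The value of a term code under an assignment of the bound variables. -/
def termVal (e : List M) (t : ℕ) : M :=
  if t.unpair.1 = 0 then fv t.unpair.2
  else if t.unpair.1 = 1 then e.getD t.unpair.2 (fv 0)
  else if t.unpair.1 = 2 then
    fn t.unpair.2.unpair.1 t.unpair.2.unpair.2.unpair.1
      ((termArgs t).attach.map fun s => termVal e s.1)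
  else fv 0
termination_by t
decreasing_by exact mem_termArgs_lt s.2

theorem termVal_eq (e : List M) (t : ℕ) : termVal fn fv e t =
    if t.unpair.1 = 0 then fv t.unpair.2
    else if t.unpair.1 = 1 then e.getD t.unpair.2 (fv 0)
    else if t.unpair.1 = 2 then
      fn t.unpair.2.unpair.1 t.unpair.2.unpair.2.unpair.1
        ((termArgs t).map fun s => termVal fn fv e s)
    else fv 0 := by
  rw [termVal, List.attach_map_val (f := fun s => termVal fn fv e s)]

/-- Truth of a formula code under an assignment of the bound variables. -/
def FormulaTrue (e : List M) (a : ℕ) : Prop :=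
  if a.unpair.1 = 2 then
    rl a.unpair.2.unpair.1 a.unpair.2.unpair.2.unpair.1 ((termArgs a).map (termVal fn fv e))
  else if _ : a.unpair.1 = 3 then
    FormulaTrue e a.unpair.2.unpair.1 → FormulaTrue e a.unpair.2.unpair.2
  else if _ : a.unpair.1 = 4 then ∀ m, FormulaTrue (e ++ [m]) a.unpair.2
  else False
termination_by a
decreasing_by
  · exact left_lt (by omega)
  · exact right_lt (by omega)
  · exact unpair_snd_lt (by omega)

theorem formulaTrue_zero (e : List M) : ¬ FormulaTrue fn rl fv e 0 := by
  rw [FormulaTrue]; simp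

theorem formulaTrue_rel (e : List M) (a : ℕ) : FormulaTrue fn rl fv e (Nat.pair 2 a) ↔
    rl a.unpair.1 a.unpair.2.unpair.1 ((codeList a.unpair.2.unpair.2).map (termVal fn fv e)) := by
  rw [FormulaTrue]; simp [termArgs]

theorem formulaTrue_imp (e : List M) (a b : ℕ) :
    FormulaTrue fn rl fv e (Nat.pair 3 (Nat.pair a b)) ↔
      (FormulaTrue fn rl fv e a → FormulaTrue fn rl fv e b) := by
  rw [FormulaTrue]; simp

theorem formulaTrue_all (e : List M) (a : ℕ) :
    FormulaTrue fn rl fv e (Nat.pair 4 a) ↔ ∀ m, FormulaTrue fn rl fv (e ++ [m]) a := by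
  rw [FormulaTrue]; simp

/-- The value of a ground term code that may contain Henkin witnesses. -/
noncomputable def groundVal (t : ℕ) : M :=
  haveI : Nonempty M := ⟨fv 0⟩
  if t.unpair.1 = 0 then fv t.unpair.2
  else if t.unpair.1 = 2 then
    fn t.unpair.2.unpair.1 t.unpair.2.unpair.2.unpair.1
      ((termArgs t).attach.map fun s => groundVal s.1)
  else if _ : t.unpair.1 = 3 then
    -- Only the environment contains codes that have to be evaluated recursively, and they are
    -- smaller than the witness; the truth of the formula code does not involve `groundVal`.
    Classical.epsilon fun m => ¬ FormulaTrue fn rl fv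
      (((codeList t.unpair.2.unpair.1).attach.map fun s => groundVal s.1) ++ [m]) t.unpair.2.unpair.2
  else fv 0
termination_by t
decreasing_by
  · exact mem_termArgs_lt s.2
  · exact (mem_codeList_lt s.2).trans (left_lt (by omega))

theorem groundVal_eq (t : ℕ) : groundVal fn rl fv t =
    haveI : Nonempty M := ⟨fv 0⟩
    if t.unpair.1 = 0 then fv t.unpair.2
    else if t.unpair.1 = 2 then
      fn t.unpair.2.unpair.1 t.unpair.2.unpair.2.unpair.1
        ((termArgs t).map fun s => groundVal fn rl fv s)
    else if t.unpair.1 = 3 then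
      Classical.epsilon fun m => ¬ FormulaTrue fn rl fv
        (((codeList t.unpair.2.unpair.1).map fun s => groundVal fn rl fv s) ++ [m])
        t.unpair.2.unpair.2
    else fv 0 := by
  rw [groundVal, List.attach_map_val (f := fun s => groundVal fn rl fv s),
    List.attach_map_val (f := fun s => groundVal fn rl fv s)]
  simp only [dite_eq_ite]

theorem groundVal_zero : groundVal fn rl fv 0 = fv 0 := by
  rw [groundVal_eq]; simp

/-- The substitution lemma: it makes the variable of an atom under an environment agree with the
variable of its ground instance. -/
theorem groundVal_subst (e : List ℕ) (t : ℕ) :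
    groundVal fn rl fv (subst e t) = termVal fn fv (e.map (groundVal fn rl fv)) t := by
  induction t using Nat.strong_induction_on with
  | _ t ih =>
    rw [subst_eq, termVal_eq]
    split_ifs with h0 h1 h2
    · rw [groundVal_eq]; simp [h0]
    · rw [← groundVal_zero fn rl fv, List.getD_map]
    · rw [groundVal_eq]
      simp only [Nat.unpair_pair, OfNat.ofNat_ne_zero, if_false, if_true, termArgs,
        codeList_encode, List.map_map]
      congr 1
      refine List.map_congr_left fun s hs => ih s (mem_termArgs_lt hs)
    · exact groundVal_zero fn rl fv

open Classical in
/-- The valuation of the propositional variables. -/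
noncomputable def valuation (n : ℕ) : Bool :=
  if n.unpair.1 = 0 then decide (FormulaTrue fn rl fv
    ((codeList n.unpair.2.unpair.1).map (groundVal fn rl fv)) n.unpair.2.unpair.2)
  else decide (rl n.unpair.2.unpair.1 n.unpair.2.unpair.2.unpair.1
    ((codeList n.unpair.2.unpair.2.unpair.2).map (groundVal fn rl fv)))

open Classical in
theorem valuation_formulaVar (e : List ℕ) (a : ℕ) : valuation fn rl fv (formulaVar e a) = true ↔
    FormulaTrue fn rl fv (e.map (groundVal fn rl fv)) a := by
  rw [valuation, formulaVar, if_pos (by simp), decide_eq_true_eq]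
  simp

open Classical in
theorem valuation_atomVar (e : List ℕ) (a : ℕ) :
    valuation fn rl fv (atomVar (substAtom e a)) =
      valuation fn rl fv (formulaVar e (Nat.pair 2 a)) := by
  rw [Bool.eq_iff_iff, valuation_formulaVar, formulaTrue_rel]
  rw [valuation, atomVar, if_neg (by simp), decide_eq_true_eq]
  simp only [substAtom, Nat.unpair_pair, codeList_encode, List.map_map]
  rw [List.map_congr_left (f := groundVal fn rl fv ∘ fun s => subst e s)
    (g := termVal fn fv (e.map (groundVal fn rl fv))) fun s _ => groundVal_subst fn rl fv e s]

/-- The witness is evaluated to a counterexample whenever there is one, so truth at the witness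
forces truth everywhere. -/
theorem valuation_witness (e : List ℕ) (a : ℕ)
    (h : FormulaTrue fn rl fv ((e ++ [witness e a]).map (groundVal fn rl fv)) a) :
    FormulaTrue fn rl fv (e.map (groundVal fn rl fv)) (Nat.pair 4 a) := by
  rw [formulaTrue_all]
  by_contra hm
  push Not at hm
  have := Classical.epsilon_spec hm
  rw [List.map_append, List.map_singleton, groundVal_eq fn rl fv (witness e a)] at h
  simp only [witness, Nat.unpair_pair, OfNat.ofNat_ne_zero, if_false, if_true,
    codeList_encode, Nat.reduceEqDiff] at h
  exact this h

/-- A countermodel satisfies the clauses: connectives and instances follow Tarski's truth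
conditions, the Henkin clause follows from the choice of witnesses, and the atom clauses from the
substitution lemma. -/
theorem satClause_valuation {φ : ℕ} (hφ : ¬ FormulaTrue fn rl fv [] φ) (j : ℕ) :
    SatClause (valuation fn rl fv) (henkinClause φ j) := by
  revert j
  rw [forall_henkinClause]
  intro e a b c hc
  have key := valuation_formulaVar fn rl fv
  have key' : ∀ e a, valuation fn rl fv (formulaVar e a) = false ↔
    ¬ FormulaTrue fn rl fv (e.map (groundVal fn rl fv)) a := fun e a => by
      rw [← key, Bool.not_eq_true]
  simp only [henkinClauses, List.mem_cons, List.not_mem_nil, or_false] at hc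
  rcases hc with rfl | rfl | rfl | rfl | rfl | rfl | rfl | rfl | rfl <;>
    simp only [SatClause, List.mem_cons, List.not_mem_nil, or_false, exists_eq_or_imp,
      exists_eq_left, key, key', valuation_atomVar, formulaTrue_imp]
  · exact hφ
  · exact formulaTrue_zero fn rl fv _
  · tauto
  · tauto
  · tauto
  · rw [formulaTrue_all, List.map_append, List.map_singleton]
    by_cases h : ∀ m, FormulaTrue fn rl fv (e.map (groundVal fn rl fv) ++ [m]) a
    · exact .inr (h _)
    · exact .inl h
  · by_cases h : FormulaTrue fn rl fv ((e ++ [witness e a]).map (groundVal fn rl fv)) a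
    · exact .inl (valuation_witness fn rl fv e a h)
    · exact .inr h
  · tauto
  · tauto

end NumberSemantics

end LPInterpolation

namespace LPInterpolation

open Language

/-! ### Validity by Henkin clauses -/

theorem ofFn_snoc {M : Type*} {n : ℕ} (xs : Fin n → M) (m : M) :
    List.ofFn (Fin.snoc xs m : Fin (n + 1) → M) = List.ofFn xs ++ [m] := by
  rw [List.ofFn_succ', List.concat_eq_append]
  simp

theorem ofFn_getD {M : Type*} {n : ℕ} (xs : Fin n → M) (i : Fin n) (d : M) :
    (List.ofFn xs).getD i d = xs i := by
  simp [List.getD_eq_getElem?_getD]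

theorem entails_iff {L : FirstOrder.Language.{u, v}} {α : Type w} {F G : L.Formula α} :
    Entails F G ↔ ∀ (M : Type (max u v w)) [L.Structure M] [Nonempty M] (x : α → M),
      F.Realize x → G.Realize x := by
  rw [Entails, Theory.models_formula_iff]
  constructor
  · intro h M _ _ x
    have : M ⊨ (∅ : L.Theory) := by simp
    exact Formula.realize_imp.1 (h (Theory.ModelType.of ∅ M) x)
  · intro h M x
    exact Formula.realize_imp.2 (h M x)

/-- The relations of a structure, indexed by Gödel numbers. -/
def structRel (L : FirstOrder.Language.{u, v}) [∀ k, Encodable (L.Relations k)]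
    {M : Type*} [(zeroOne L).Structure M] (l r : ℕ) (ms : List M) : Prop :=
  ∃ (R : L.Relations l) (i : Fin 2) (x : Fin l → M), Nat.pair (Encodable.encode R) i = r ∧
    List.ofFn x = ms ∧ Structure.RelMap (L := zeroOne L) (R, i) x

theorem structRel_encode {L : FirstOrder.Language.{u, v}} [∀ k, Encodable (L.Relations k)]
    {M : Type*} [(zeroOne L).Structure M] {l : ℕ} (R : (zeroOne L).Relations l) (x : Fin l → M) :
    structRel L l (Nat.pair (Encodable.encode R.1) R.2) (List.ofFn x) ↔ Structure.RelMap R x := by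
  constructor
  · rintro ⟨R', i, x', h1, h2, h3⟩
    rw [Nat.pair_eq_pair] at h1
    rw [List.ofFn_injective h2, Encodable.encode_injective h1.1, Fin.ext h1.2] at h3
    exact h3
  · intro h
    exact ⟨R.1, R.2, x, rfl, rfl, h⟩

variable {L : FirstOrder.Language.{u, v}} {α : Type w} [∀ k, Encodable (L.Functions k)]
  [Encodable α]

/-! ### Structures read as interpretations of Gödel numbers -/

section Soundness

variable {M : Type*} [(zeroOne L).Structure M] [Nonempty M]

open Classical in
/-- The functions of a structure, indexed by Gödel numbers. -/
noncomputable def structFun (L : FirstOrder.Language.{u, v}) [∀ k, Encodable (L.Functions k)]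
    {M : Type*} [(zeroOne L).Structure M] [Nonempty M] (l f : ℕ) (ms : List M) : M :=
  if h : ∃ (g : L.Functions l) (x : Fin l → M), Encodable.encode g = f ∧ List.ofFn x = ms then
    Structure.funMap (L := zeroOne L) h.choose h.choose_spec.choose
  else Classical.arbitrary M

theorem structFun_encode {l : ℕ} (g : L.Functions l) (x : Fin l → M) :
    structFun L l (Encodable.encode g) (List.ofFn x) = Structure.funMap (L := zeroOne L) g x := by
  have h : ∃ (g' : L.Functions l) (x' : Fin l → M),
    Encodable.encode g' = Encodable.encode g ∧ List.ofFn x' = List.ofFn x := ⟨g, x, rfl, rfl⟩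
  rw [structFun, dif_pos h]
  have h2 := h.choose_spec.choose_spec
  rw [List.ofFn_injective h2.2]
  congr 1
  exact Encodable.encode_injective h2.1

open Classical in
/-- An assignment of the free variables, indexed by Gödel numbers. -/
noncomputable def structVar (x : α → M) (n : ℕ) : M :=
  if h : ∃ a, Encodable.encode a = n then x h.choose else Classical.arbitrary M

theorem structVar_encode (x : α → M) (a : α) : structVar x (Encodable.encode a) = x a := by
  have h : ∃ a', Encodable.encode a' = Encodable.encode a := ⟨a, rfl⟩
  rw [structVar, dif_pos h, Encodable.encode_injective h.choose_spec]

theorem termVal_termCode (x : α → M) {n : ℕ} (xs : Fin n → M)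
    (t : (zeroOne L).Term (α ⊕ Fin n)) :
    termVal (structFun L) (structVar x) (List.ofFn xs) (termCode t) =
      t.realize (Sum.elim x xs) := by
  induction t with
  | var y =>
    rcases y with a | i
    · rw [termCode, termVal_eq]; simp [structVar_encode]
    · rw [termCode, termVal_eq]
      simp only [Nat.unpair_pair, one_ne_zero, if_false, if_true, ofFn_getD]
      rfl
  | func f ts ih =>
    rw [termCode, termVal_eq]
    simp only [Nat.unpair_pair, OfNat.ofNat_ne_zero, if_false, if_true, termArgs,
      codeList_encode, List.map_ofFn, Nat.reduceEqDiff]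
    rw [Term.realize, ← structFun_encode]
    congr 2
    funext i
    exact ih i

variable [∀ k, Encodable (L.Relations k)]

theorem formulaTrue_code (x : α → M) {n : ℕ} (φ : (zeroOne L).BoundedFormula α n) (hφ : EqFree φ)
    (xs : Fin n → M) : FormulaTrue (structFun L) (structRel L) (structVar x) (List.ofFn xs)
      (code φ) ↔ φ.Realize x xs := by
  induction φ with
  | falsum =>
    rw [code, show Nat.pair 0 0 = 0 from rfl]
    exact iff_of_false (formulaTrue_zero _ _ _ _) id
  | equal => exact hφ.elim
  | rel R ts =>
    rw [code, formulaTrue_rel]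
    simp only [Nat.unpair_pair, codeList_encode, List.map_ofFn]
    rw [show (termVal (structFun L) (structVar x) (List.ofFn xs) ∘ fun i => termCode (ts i)) =
      fun i => (ts i).realize (Sum.elim x xs) from funext fun i => termVal_termCode x xs (ts i)]
    exact structRel_encode R _
  | imp f g ihf ihg =>
    rw [code, formulaTrue_imp, ihf hφ.1, ihg hφ.2, BoundedFormula.realize_imp]
  | all f ih =>
    rw [code, formulaTrue_all, BoundedFormula.realize_all]
    refine forall_congr' fun m => ?_
    rw [← ofFn_snoc, ih hφ]

end Soundness

/-! ### The countermodel given by a satisfying valuation -/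

section Completeness

/-- A valuation that satisfies the Henkin clauses respects connectives and quantifiers. -/
theorem forall_satClause_henkinClause {x : ℕ → Bool} {φ : ℕ}
    (hx : ∀ j, SatClause x (henkinClause φ j)) :
    x (formulaVar [] φ) = false ∧ ∀ e, x (formulaVar e 0) = false ∧
      (∀ a b, x (formulaVar e (Nat.pair 3 (Nat.pair a b))) = true ↔
        (x (formulaVar e a) = true → x (formulaVar e b) = true)) ∧
      (∀ a, x (formulaVar e (Nat.pair 4 a)) = true ↔
        ∀ b, x (formulaVar (e ++ [b]) a) = true) ∧
      ∀ a, x (formulaVar e (Nat.pair 2 a)) = x (atomVar (substAtom e a)) := by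
  have key : ∀ e a b, _ := forall_henkinClause.1 hx
  simp only [henkinClauses, List.forall_mem_cons] at key
  simp only [SatClause, List.mem_cons, List.not_mem_nil, or_false, exists_eq_or_imp,
    exists_eq_left] at key
  refine ⟨(key [] 0 0).1, fun e => ⟨(key e 0 0).2.1, fun a b => ?_, fun a => ⟨fun h b => ?_,
    fun h => ?_⟩, fun a => ?_⟩⟩
  · obtain ⟨-, -, h1, h2, h3, -⟩ := key e a b
    revert h1 h2 h3
    cases x (formulaVar e a) <;> cases x (formulaVar e b) <;>
    cases x (formulaVar e (Nat.pair 3 (Nat.pair a b))) <;> simp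
  · obtain ⟨-, -, -, -, -, h1, -⟩ := key e a b
    simpa [h] using h1
  · obtain ⟨-, -, -, -, -, -, h1, -⟩ := key e a 0
    simpa [h] using h1
  · obtain ⟨-, -, -, -, -, -, -, h1, h2, -⟩ := key e a 0
    revert h1 h2
    cases x (formulaVar e (Nat.pair 2 a)) <;> cases x (atomVar (substAtom e a)) <;> simp

variable [∀ k, Encodable (L.Relations k)]

universe z

/-- The domain of the structure given by a valuation of the propositional variables. -/
structure HenkinModel (x : ℕ → Bool) : Type z where
  /-- The underlying number. -/
  toNat : ℕ

instance (x : ℕ → Bool) : Nonempty (HenkinModel.{z} x) := ⟨⟨0⟩⟩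

/-- Functions build term codes. The domain consists of all numbers, not only of term codes; this is
harmless because the instance clauses for the quantifier also range over all numbers. -/
instance henkinStructure (L : FirstOrder.Language.{u, v}) [∀ k, Encodable (L.Functions k)]
    [∀ k, Encodable (L.Relations k)] (x : ℕ → Bool) :
    (zeroOne L).Structure (HenkinModel.{z} x) where
  funMap {l} f ms := ⟨Nat.pair 2 (Nat.pair l (Nat.pair
    (Encodable.encode (α := L.Functions l) f)
    (Encodable.encode (List.ofFn fun i => (ms i).toNat))))⟩
  RelMap {l} R ms := x (atomVar (Nat.pair l (Nat.pair
    (Nat.pair (Encodable.encode (α := L.Relations l) R.1) R.2)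
    (Encodable.encode (List.ofFn fun i => (ms i).toNat))))) = true

/-- The free variables as numbers. -/
def henkinVar (x : ℕ → Bool) (a : α) : HenkinModel.{z} x := ⟨Nat.pair 0 (Encodable.encode a)⟩

theorem realize_term_henkinModel (x : ℕ → Bool) {n : ℕ} (xs : Fin n → HenkinModel.{z} x)
    (t : (zeroOne L).Term (α ⊕ Fin n)) :
    (t.realize (Sum.elim (henkinVar x) xs)).toNat =
      subst (List.ofFn fun i => (xs i).toNat) (termCode t) := by
  induction t with
  | var y =>
    rcases y with a | i
    · rw [termCode, subst_eq]; simp [henkinVar]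
    · rw [termCode, subst_eq]
      simp only [Nat.unpair_pair, one_ne_zero, if_false, if_true]
      rw [ofFn_getD (fun i => (xs i).toNat)]
      rfl
  | func f ts ih =>
    rw [termCode, subst_eq]
    simp only [Nat.unpair_pair, OfNat.ofNat_ne_zero, if_false, if_true, termArgs,
      codeList_encode, List.map_ofFn, Nat.reduceEqDiff]
    rw [Term.realize]
    simp only [Structure.funMap, ih]
    rfl

/-- The truth lemma, by induction on the formula: the clauses are exactly the truth conditions, and
without equality the distinctness of elements never matters. -/
theorem realize_henkinModel {x : ℕ → Bool} {φ₀ : ℕ} (hx : ∀ j, SatClause x (henkinClause φ₀ j))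
    {n : ℕ} (φ : (zeroOne L).BoundedFormula α n) (hφ : EqFree φ)
    (xs : Fin n → HenkinModel.{z} x) : φ.Realize (henkinVar x) xs ↔
      x (formulaVar (List.ofFn fun i => (xs i).toNat) (code φ)) = true := by
  have key := (forall_satClause_henkinClause hx).2
  induction φ with
  | falsum => exact iff_of_false id (by rw [code, show Nat.pair 0 0 = 0 from rfl, (key _).1]; simp)
  | equal => exact hφ.elim
  | rel R ts =>
    rw [code, (key _).2.2.2]
    simp only [substAtom, Nat.unpair_pair, codeList_encode, List.map_ofFn]
    simp only [BoundedFormula.Realize, Structure.RelMap, realize_term_henkinModel x xs]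
    rfl
  | imp f g ihf ihg =>
    rw [BoundedFormula.realize_imp, code, (key _).2.1]
    exact imp_congr (ihf hφ.1 xs) (ihg hφ.2 xs)
  | all f ih =>
    rw [BoundedFormula.realize_all, code, (key _).2.2.1]
    have : ∀ m : HenkinModel.{z} x, f.Realize (henkinVar x) (Fin.snoc xs m) ↔
        x (formulaVar ((List.ofFn fun i => (xs i).toNat) ++ [m.toNat]) (code f)) = true := by
      intro m
      refine (ih hφ _).trans ?_
      rw [← ofFn_snoc]
      have : (fun i => (Fin.snoc (α := fun _ => HenkinModel.{z} x) xs m i).toNat) =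
          Fin.snoc (α := fun _ => ℕ) (fun i => (xs i).toNat) m.toNat := by
        funext i
        refine Fin.lastCases ?_ (fun i => ?_) i <;> simp
      rw [this]
    simp only [this]
    exact ⟨fun h b => h ⟨b⟩, fun h m => h m.toNat⟩

end Completeness

/-- Entailment between formulas without equality is characterized by the existence of a
certificate. -/
theorem entails_iff_exists_unsatCert [∀ k, Encodable (L.Relations k)]
    {F G : (zeroOne L).Formula α} (hF : EqFree F) (hG : EqFree G) :
    Entails F G ↔
      ∃ N, UnsatCert (henkinClause (Nat.pair 3 (Nat.pair (code F) (code G)))) N := by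
  rw [exists_unsatCert_iff, entails_iff]
  have hFG : EqFree (F.imp G) := ⟨hF, hG⟩
  constructor
  · rintro h ⟨x, hx⟩
    have h1 := (forall_satClause_henkinClause hx).1
    -- The clauses force the variable of the implication to be false, so the Henkin model refutes
    -- it.
    have h2 := realize_henkinModel.{u, v, w, max u v w} hx (F.imp G) hFG default
    rw [List.ofFn_zero, code, h1] at h2
    exact absurd (h2.1 fun hF => h _ _ hF) (by simp)
  · intro h M _ _ x hxF
    by_contra hxG
    apply h
    refine ⟨_, satClause_valuation (structFun L) (structRel L) (structVar x) ?_⟩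
    have := formulaTrue_code x (F.imp G) hFG (default : Fin 0 → M)
    rw [List.ofFn_zero, code] at this
    rw [this]
    intro h'
    exact hxG (h' hxF)

end LPInterpolation

namespace LPInterpolation

open Language

/-! ### Vocabulary of conjunctions and universal closures -/

section Vocabulary

variable {L : FirstOrder.Language.{u, v}} {α : Type w} {n : ℕ}

theorem eqFree_inf {f g : L.BoundedFormula α n} : EqFree (f ⊓ g) ↔ EqFree f ∧ EqFree g := by
  change ((EqFree f ∧ (EqFree g ∧ True)) ∧ True) ↔ _
  simp

theorem fun_inf (f g : L.BoundedFormula α n) : Fun (f ⊓ g) = Fun f ∪ Fun g := by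
  change ((Fun f ∪ (Fun g ∪ ∅)) ∪ ∅) = _
  simp

theorem predPolAux_inf (s : Bool) (f g : L.BoundedFormula α n) :
    predPolAux s (f ⊓ g) = predPolAux s f ∪ predPolAux s g := by
  change ((predPolAux (!!s) f ∪ (predPolAux (!!s) g ∪ ∅)) ∪ ∅) = _
  simp

theorem univAux_inf {s : Bool} {f g : L.BoundedFormula α n} :
    univAux s (f ⊓ g) ↔ univAux s f ∧ univAux s g := by
  change ((univAux (!!s) f ∧ (univAux (!!s) g ∧ True)) ∧ True) ↔ _
  simp

theorem freeVarFinset_inf [DecidableEq α] (f g : L.BoundedFormula α n) :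
    (f ⊓ g).freeVarFinset = f.freeVarFinset ∪ g.freeVarFinset := by
  change ((f.freeVarFinset ∪ (g.freeVarFinset ∪ ∅)) ∪ ∅) = _
  simp

theorem eqFree_alls {f : L.BoundedFormula α n} : EqFree f.alls ↔ EqFree f := by
  induction n with
  | zero => rfl
  | succ n ih => exact ih

theorem fun_alls (f : L.BoundedFormula α n) : Fun f.alls = Fun f := by
  induction n with
  | zero => rfl
  | succ n ih => exact ih _

theorem predPolAux_alls (s : Bool) (f : L.BoundedFormula α n) :
    predPolAux s f.alls = predPolAux s f := by
  induction n with
  | zero => rfl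
  | succ n ih => exact ih _

theorem univAux_alls {f : L.BoundedFormula α n} : univAux true f.alls ↔ univAux true f := by
  induction n with
  | zero => rfl
  | succ n ih => exact ih.trans (by simp [univAux])

theorem freeVarFinset_alls [DecidableEq α] (f : L.BoundedFormula α n) :
    f.alls.freeVarFinset = f.freeVarFinset := by
  induction n with
  | zero => rfl
  | succ n ih => exact ih _

end Vocabulary

/-! ### Renaming of superscripts, syntactically and semantically -/

section Rename

variable {L : FirstOrder.Language.{u, v}} {α : Type w} {n : ℕ}

theorem termFun_onTerm {β : Type*} (t : (zeroOne L).Term β) :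
    termFun ((renameHom L).onTerm t) = termFun t := by
  induction t with
  | var => rfl
  | func f ts ih =>
    simp only [LHom.onTerm, termFun, ih]
    rfl

theorem fun_rename (f : (zeroOne L).BoundedFormula α n) :
    Fun ((renameHom L).onBoundedFormula f) = Fun f := by
  induction f with
  | falsum => rfl
  | equal => simp only [LHom.onBoundedFormula, Term.bdEqual, Fun, termFun_onTerm]
  | rel R ts =>
    simp only [LHom.onBoundedFormula, Relations.boundedFormula, Fun, Function.comp_apply,
      termFun_onTerm]
  | imp f g ihf ihg => simp only [LHom.onBoundedFormula, Fun, ihf, ihg]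
  | all f ih => simp only [LHom.onBoundedFormula, Fun, ih]

theorem eqFree_rename (f : (zeroOne L).BoundedFormula α n) :
    EqFree ((renameHom L).onBoundedFormula f) ↔ EqFree f := by
  induction f with
  | falsum => rfl
  | equal => rfl
  | rel R ts => rfl
  | imp f g ihf ihg => exact and_congr ihf ihg
  | all f ih => exact ih

theorem univAux_rename (s : Bool) (f : (zeroOne L).BoundedFormula α n) :
    univAux s ((renameHom L).onBoundedFormula f) ↔ univAux s f := by
  induction f generalizing s with
  | falsum => rfl
  | equal => rfl
  | rel R ts => rfl
  | imp f g ihf ihg => exact and_congr (ihf _) (ihg _)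
  | all f ih => exact and_congr_right fun _ => ih _

theorem predPolAux_rename (s : Bool) (f : (zeroOne L).BoundedFormula α n) :
    predPolAux s ((renameHom L).onBoundedFormula f) =
      (fun x => (x.1, ⟨x.2.1, (x.2.2.1, 1)⟩)) '' predPolAux s f := by
  induction f generalizing s with
  | falsum => exact (Set.image_empty _).symm
  | equal => exact (Set.image_empty _).symm
  | rel R ts =>
    simp only [LHom.onBoundedFormula, Relations.boundedFormula, predPolAux, Set.image_singleton]
    rfl
  | imp f g ihf ihg =>
    simp only [LHom.onBoundedFormula, predPolAux, ihf, ihg, Set.image_union]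
  | all f ih => exact ih _

theorem rename01_rename01 (f : (zeroOne L).Formula α) : rename01 (rename01 f) = rename01 f := by
  have h := congrFun (LHom.comp_onBoundedFormula (n := 0) (α := α) (renameHom L) (renameHom L)) f
  exact h.symm

theorem rename01_inf (f g : (zeroOne L).Formula α) :
    rename01 (f ⊓ g) = rename01 f ⊓ rename01 g := rfl

/-- The structure in which the predicates `p⁰` are interpreted by the predicates `p¹`. -/
abbrev renameReduct (L : FirstOrder.Language.{u, v}) (M : Type*) [(zeroOne L).Structure M] :
    (zeroOne L).Structure M := (renameHom L).reduct M

/-- Changing the formula is traded for changing the structure; this lets an entailment be applied to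
the reinterpreted structure. -/
theorem realize_rename01 {M : Type*} [I : (zeroOne L).Structure M] (f : (zeroOne L).Formula α)
    (x : α → M) :
    (rename01 f).Realize x ↔ @Formula.Realize _ M (renameReduct L M) _ f x :=
  @LHom.realize_onFormula (zeroOne L) (zeroOne L) M (renameReduct L M) α I (renameHom L)
    (LHom.isExpansionOn_reduct _ _) f x

end Rename

/-! ### The axioms p⁰ → p¹ -/

section SFormula

variable {L : FirstOrder.Language.{u, v}} {α : Type w}

theorem S_induction {P : (zeroOne L).Formula α → Prop} (htop : P ⊤)
    (hinf : ∀ p K, P K → P (zeroImpOne p ⊓ K)) (F : (zeroOne L).Formula α) : P (S F) := by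
  unfold S
  induction predLP F with
  | nil => exact htop
  | cons p l ih => exact hinf p _ ih

theorem eqFree_S (F : (zeroOne L).Formula α) : EqFree (S F) :=
  S_induction ⟨trivial, trivial⟩ (fun p K h => eqFree_inf.2 ⟨by
    simp [zeroImpOne, eqFree_alls, EqFree, Relations.boundedFormula], h⟩) F

theorem univAux_S (F : (zeroOne L).Formula α) : univAux true (S F) :=
  S_induction ⟨trivial, trivial⟩ (fun p K h => univAux_inf.2 ⟨by
    simp [zeroImpOne, univAux_alls, univAux, Relations.boundedFormula], h⟩) F

theorem fun_zeroImpOne (p : Σ k, L.Relations k) :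
    Fun (zeroImpOne p : (zeroOne L).Formula α) = ∅ := by
  rw [zeroImpOne, fun_alls]
  simp [Fun, Relations.boundedFormula, termFun]

theorem fun_S (F : (zeroOne L).Formula α) : Fun (S F) = ∅ :=
  S_induction (P := fun K => Fun K = ∅) (Set.union_empty _)
    (fun p K h => by rw [fun_inf, fun_zeroImpOne, h, Set.union_empty]) F

theorem freeVarFinset_zeroImpOne [DecidableEq α] (p : Σ k, L.Relations k) :
    (zeroImpOne p : (zeroOne L).Formula α).freeVarFinset = ∅ := by
  rw [zeroImpOne, freeVarFinset_alls]
  ext; simp [BoundedFormula.freeVarFinset, Relations.boundedFormula]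

theorem freeVarFinset_S [DecidableEq α] (F : (zeroOne L).Formula α) :
    (S F).freeVarFinset = ∅ :=
  S_induction (P := fun K => K.freeVarFinset = ∅) (Finset.union_empty _)
    (fun p K h => by rw [freeVarFinset_inf, freeVarFinset_zeroImpOne, h, Finset.union_empty]) F

/-- In the reduct p⁰ and p¹ have the same interpretation, so each conjunct reads p¹ → p¹. -/
theorem realize_S_renameReduct {M : Type*} [I : (zeroOne L).Structure M]
    (F : (zeroOne L).Formula α) (x : α → M) :
    @Formula.Realize _ M (renameReduct L M) _ (S F) x := by
  let _ := renameReduct L M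
  refine @S_induction L α (fun K => @Formula.Realize _ M (renameReduct L M) _ K x) ?_ ?_ F
  · exact fun h => h
  · intro p K h
    refine (@Formula.realize_inf _ M (renameReduct L M) _ _ _ _).2 ⟨?_, h⟩
    refine (@BoundedFormula.realize_alls _ M (renameReduct L M) _ _ _ _).2 fun xs => ?_
    exact fun h => h

end SFormula

/-! ### From Craig-Lyndon interpolants to LP-interpolants -/

theorem isLPInterpolant_inf_rename01 {L : FirstOrder.Language.{u, v}} {α : Type w}
    {F G H : (zeroOne L).Formula α} (hF : EncodesLP F) (hH : Universal H)
    (h : IsCraigLyndonInterpolant (S F ⊓ F) ((S G).imp G) H) :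
    IsLPInterpolant F G (H ⊓ rename01 H) where
  eqFree := eqFree_inf.2 ⟨h.eqFree, (eqFree_rename H).2 h.eqFree⟩
  left := by
    rw [entails_iff]
    intro M _ _ x hx
    refine Formula.realize_inf.2 ⟨entails_iff.1 h.left M x hx, ?_⟩
    rw [realize_rename01]
    -- The entailment is used a second time, in the reduct. There `S F` is trivial, and `F` holds
    -- because `F` encodes a logic program.
    have h2 := entails_iff.1 h.left
    refine @h2 M (renameReduct L M) _ x ?_
    refine (@Formula.realize_inf _ M (renameReduct L M) _ _ _ _).2
      ⟨realize_S_renameReduct F x, ?_⟩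
    exact (realize_rename01 F x).1 (entails_iff.1 hF.2 M x hx)
  right := by
    rw [entails_iff]
    intro M _ _ x hx
    exact entails_iff.1 h.right M x (Formula.realize_inf.1 hx).1
  predPol := by
    rw [PredPol, predPolAux_inf]
    refine Set.union_subset (h.predPol.trans Set.subset_union_left) ?_
    rw [rename01, LHom.onFormula, predPolAux_rename]
    rintro _ ⟨⟨s, k, p, i⟩, hp, rfl⟩
    have := h.predPol hp
    fin_cases i
    · exact .inr ⟨s, k, p, this, rfl⟩
    · exact .inl this
  func := by
    rw [fun_inf, rename01, LHom.onFormula, fun_rename, Set.union_self]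
    refine h.func.trans (Set.inter_subset_left.trans ?_)
    rw [fun_inf, fun_S, Set.empty_union]
  encodes := by
    refine ⟨univAux_inf.2 ⟨hH, (univAux_rename true H).2 hH⟩, ?_⟩
    rw [entails_iff, rename01_inf, rename01_rename01]
    intro M _ _ x hx
    -- By idempotence both conjuncts of the renamed formula are the second conjunct of the formula
    -- itself.
    have := (Formula.realize_inf.1 (Formula.realize_inf.1 hx).2).2
    exact Formula.realize_inf.2 ⟨this, this⟩

end LPInterpolation

namespace LPInterpolation

open Language

universe i z

/-! ### Compactness for formulas with free variables -/

section Compactness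

variable {L : FirstOrder.Language.{u, v}} {β : Type w}

/-- An ultraproduct, over the finite index sets, of models of the finite subfamilies; assignments
are carried along by Łoś's theorem. -/
theorem exists_realize_of_finite {ι : Type i} (A : L.Formula β) (ψ : ι → L.Formula β)
    (h : ∀ s : Finset ι, ∃ (M : Type z) (_ : L.Structure M) (_ : Nonempty M) (x : β → M),
      A.Realize x ∧ ∀ j ∈ s, (ψ j).Realize x) :
    ∃ (M : Type (max i z)) (_ : L.Structure M) (_ : Nonempty M) (x : β → M),
      A.Realize x ∧ ∀ j, (ψ j).Realize x := by
  choose M I hne x hA hψ using h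
  -- Finer than `atTop`, so for each `j` almost every finite set contains `j`.
  let U : Ultrafilter (Finset ι) := Ultrafilter.of Filter.atTop
  have key := fun φ : L.Formula β =>
    Ultraproduct.realize_formula_cast (M := M) (u := U) φ fun b s => x s b
  refine ⟨_, _, Ultraproduct.Product.instNonempty (M := M) (u := U), _,
    (key A).2 (Filter.Eventually.of_forall hA), fun j => (key (ψ j)).2 ?_⟩
  have : ∀ᶠ s in (U : Filter (Finset ι)), {j} ≤ s :=
    (Filter.eventually_ge_atTop ({j} : Finset ι)).filter_mono (Ultrafilter.of_le _)
  filter_upwards [this] with s hs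
  exact hψ s j (hs (Finset.mem_singleton_self j))

end Compactness

/-! ### Transfer of truth along maps that respect polarities -/

section Transfer

variable {L : FirstOrder.Language.{u, v}} {α : Type w}

/-- Needed because truth of B is transferred forwards, where `realize_transfer` computes polarities
from the sign `false`. -/
theorem mem_predPolAux_not {n : ℕ} (σ s : Bool) (φ : L.BoundedFormula α n) (R) :
    (s, R) ∈ predPolAux (!σ) φ ↔ (!s, R) ∈ predPolAux σ φ := by
  induction φ generalizing σ with
  | falsum => rfl
  | equal => rfl
  | rel R' ts => cases s <;> cases σ <;> simp [predPolAux]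
  | imp f g ihf ihg => simp only [predPolAux, Set.mem_union, ihf, ihg]
  | all f ih => exact ih σ

theorem realize_term_transfer {β X Y : Type*} [L.Structure X] [L.Structure Y] (h : X → Y)
    (t : L.Term β)
    (hfun : ∀ k f, (⟨k, f⟩ : Σ k, L.Functions k) ∈ termFun t → ∀ xs : Fin k → X,
      h (Structure.funMap f xs) = Structure.funMap f (h ∘ xs)) (x : β → X) :
    h (t.realize x) = t.realize (h ∘ x) := by
  induction t with
  | var => rfl
  | func f ts ih =>
    simp only [termFun, Set.singleton_union, Set.mem_insert_iff, Set.mem_iUnion] at hfun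
    rw [Term.realize, Term.realize, hfun _ _ (.inl rfl)]
    congr 1
    funext j
    exact ih j fun k g hg => hfun k g (.inr ⟨j, hg⟩)

/-- A map that commutes with the functions and is compatible with the relations according to
their polarities transfers the truth of formulas without equality. -/
theorem realize_transfer {X Y : Type*} [L.Structure X] [L.Structure Y] (h : X → Y) (σ : Bool)
    {n : ℕ} (φ : L.BoundedFormula α n) (hφ : EqFree φ)
    (hq : univAux σ φ ∨ Function.Surjective h)
    (hfun : ∀ k f, (⟨k, f⟩ : Σ k, L.Functions k) ∈ Fun φ → ∀ xs : Fin k → X,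
      h (Structure.funMap f xs) = Structure.funMap f (h ∘ xs))
    (hpos : ∀ k R, (true, (⟨k, R⟩ : Σ k, L.Relations k)) ∈ predPolAux σ φ → ∀ xs : Fin k → X,
      Structure.RelMap R (h ∘ xs) → Structure.RelMap R xs)
    (hneg : ∀ k R, (false, (⟨k, R⟩ : Σ k, L.Relations k)) ∈ predPolAux σ φ → ∀ xs : Fin k → X,
      Structure.RelMap R xs → Structure.RelMap R (h ∘ xs))
    (x : α → X) (xs : Fin n → X) :
    (σ = true → φ.Realize (h ∘ x) (h ∘ xs) → φ.Realize x xs) ∧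
      (σ = false → φ.Realize x xs → φ.Realize (h ∘ x) (h ∘ xs)) := by
  induction φ generalizing σ with
  | falsum => exact ⟨fun _ h => h, fun _ h => h⟩
  | equal => exact hφ.elim
  | @rel n l R ts =>
    have key : (fun j => (ts j).realize (Sum.elim (h ∘ x) (h ∘ xs))) =
        h ∘ fun j => (ts j).realize (Sum.elim x xs) := by
      funext j
      rw [← Sum.comp_elim]
      exact (realize_term_transfer h (ts j)
        (fun k f hf => hfun k f (Set.mem_iUnion.2 ⟨j, hf⟩)) _).symm
    simp only [BoundedFormula.Realize, key]
    refine ⟨?_, ?_⟩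
    · rintro rfl
      exact hpos l R rfl _
    · rintro rfl
      exact hneg l R rfl _
  | imp f g ihf ihg =>
    have h1 := ihf (!σ) hφ.1 (hq.imp And.left id) (fun k f hf => hfun k f (.inl hf))
      (fun k R hR => hpos k R (.inl hR)) (fun k R hR => hneg k R (.inl hR)) xs
    have h2 := ihg σ hφ.2 (hq.imp And.right id) (fun k f hf => hfun k f (.inr hf))
      (fun k R hR => hpos k R (.inr hR)) (fun k R hR => hneg k R (.inr hR)) xs
    simp only [BoundedFormula.realize_imp]
    refine ⟨?_, ?_⟩
    · rintro rfl hr hf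
      exact h2.1 rfl (hr (h1.2 rfl hf))
    · rintro rfl hr hf
      exact h2.2 rfl (hr (h1.1 rfl hf))
  | all f ih =>
    have h1 := fun xs => ih σ hφ (hq.imp And.right id) hfun hpos hneg xs
    have hs : ∀ m, h ∘ (Fin.snoc xs m : Fin _ → X) = Fin.snoc (h ∘ xs) (h m) :=
      fun m => Fin.comp_snoc h xs m
    simp only [BoundedFormula.realize_all]
    refine ⟨?_, ?_⟩
    · rintro rfl hr m
      refine (h1 _).1 rfl ?_
      rw [hs]
      exact hr (h m)
    · rintro rfl hr m
      -- Forward transfer of ∀ is the only place where universality or surjectivity is needed: a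
      -- universal formula has no such occurrence, and otherwise each element of the target has a
      -- preimage.
      rcases hq with hq | hq
      · exact absurd hq.1 (by simp)
      · obtain ⟨m, rfl⟩ := hq m
        rw [← hs]
        exact (h1 _).2 rfl (hr m)

theorem realize_congr_freeVar [DecidableEq α] {M : Type*} [L.Structure M] {n : ℕ}
    (φ : L.BoundedFormula α n) {x y : α → M} (h : ∀ a ∈ φ.freeVarFinset, x a = y a)
    (xs : Fin n → M) : φ.Realize x xs ↔ φ.Realize y xs := by
  have term : ∀ {n} (xs : Fin n → M) (t : L.Term (α ⊕ Fin n)),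
      (∀ a ∈ t.varFinsetLeft, x a = y a) →
        t.realize (Sum.elim x xs) = t.realize (Sum.elim y xs) := by
    intro n xs t ht
    induction t with
    | var b =>
      rcases b with a | i
      · exact ht a (by simp)
      · rfl
    | func f ts ih =>
      rw [Term.realize, Term.realize]
      congr 1
      funext j
      exact ih j fun a ha => ht a (by
        rw [Term.varFinsetLeft]; exact Finset.mem_biUnion.2 ⟨j, Finset.mem_univ _, ha⟩)
  induction φ with
  | falsum => rfl
  | equal t s =>
    simp only [BoundedFormula.freeVarFinset, Finset.mem_union] at h
    simp only [BoundedFormula.Realize]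
    rw [term xs t fun a ha => h a (.inl ha), term xs s fun a ha => h a (.inr ha)]
  | rel R ts =>
    simp only [BoundedFormula.freeVarFinset, Finset.mem_biUnion, Finset.mem_univ, true_and] at h
    simp only [BoundedFormula.Realize]
    rw [show (fun j => (ts j).realize (Sum.elim x xs)) = fun j => (ts j).realize (Sum.elim y xs)
      from funext fun j => term xs _ fun a ha => h a ⟨j, ha⟩]
  | imp f g ihf ihg =>
    simp only [BoundedFormula.freeVarFinset, Finset.mem_union] at h
    simp only [BoundedFormula.realize_imp]
    exact imp_congr (ihf (fun a ha => h a (.inl ha)) xs) (ihg (fun a ha => h a (.inr ha)) xs)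
  | all f ih =>
    simp only [BoundedFormula.realize_all]
    exact forall_congr' fun m => ih h _

end Transfer

/-! ### Literals and clauses as formulas -/

section Literals

variable {L : FirstOrder.Language.{u, v}} {β : Type w} {n : ℕ}

/-- The negation of an atom if `s` is true, otherwise the atom. -/
def negLiteral (s : Bool) {k : ℕ} (R : L.Relations k) (us : Fin k → L.Term (β ⊕ Fin n)) :
    L.BoundedFormula β n :=
  if s then (BoundedFormula.rel R us).imp .falsum else .rel R us

theorem realize_negLiteral {M : Type*} [L.Structure M] {s : Bool} {k : ℕ} {R : L.Relations k}
    {us : Fin k → L.Term (β ⊕ Fin n)} {x : β → M} {xs : Fin n → M} :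
    (negLiteral s R us).Realize x xs ↔
      if s then ¬ Structure.RelMap R (fun j => (us j).realize (Sum.elim x xs))
      else Structure.RelMap R (fun j => (us j).realize (Sum.elim x xs)) := by
  cases s <;> rfl

/-- The clause consisting of the complements of the formulas in a list. -/
def refute (l : List (L.BoundedFormula β n)) : L.BoundedFormula β n :=
  l.foldr (fun f K => f.imp K) .falsum

theorem realize_refute {M : Type*} [L.Structure M] {l : List (L.BoundedFormula β n)} {x : β → M}
    {xs : Fin n → M} : (refute l).Realize x xs ↔ ¬ ∀ f ∈ l, f.Realize x xs := by
  induction l with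
  | nil => simpa [refute] using! id
  | cons f l ih =>
    change (f.imp (refute l)).Realize x xs ↔ _
    rw [BoundedFormula.realize_imp, ih, List.forall_mem_cons, not_and]

theorem refute_induction {P : L.BoundedFormula β n → Prop} {l : List (L.BoundedFormula β n)}
    (h0 : P .falsum) (h : ∀ f ∈ l, ∀ K, P K → P (f.imp K)) : P (refute l) := by
  induction l with
  | nil => exact h0
  | cons f l ih =>
    exact h f List.mem_cons_self _ (ih fun g hg => h g (List.mem_cons_of_mem _ hg))

end Literals

end LPInterpolation

namespace LPInterpolation

open Language

universe z

/-- Serves to replace finitely many names by finitely many bound variables. A fixed element is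
adjoined to `W`, so that elements outside also have an index. -/
theorem exists_names {D : Type*} [Nonempty D] (W : Finset D) :
    ∃ (k : ℕ) (idx : D → Fin k) (back : Fin k → D), ∀ d ∈ W, back (idx d) = d := by
  classical
  obtain ⟨d₀⟩ := ‹Nonempty D›
  let W' := insert d₀ W
  have h0 : d₀ ∈ W' := Finset.mem_insert_self _ _
  refine ⟨W'.card, fun d => if h : d ∈ W' then W'.equivFin ⟨d, h⟩ else W'.equivFin ⟨d₀, h0⟩,
    fun j => (W'.equivFin.symm j).1, fun d hd => ?_⟩
  have : d ∈ W' := Finset.mem_insert_of_mem hd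
  simp [this]

theorem realize_congr_varFinset {L : FirstOrder.Language.{u, v}} {β M : Type*} [DecidableEq β]
    [L.Structure M] {x y : β → M} (t : L.Term β) (h : ∀ b ∈ t.varFinset, x b = y b) :
    t.realize x = t.realize y := by
  induction t with
  | var b => exact h b (by simp)
  | func f ts ih =>
    rw [Term.realize, Term.realize]
    congr 1
    funext j
    exact ih j fun a ha => h a (by
      rw [Term.varFinset]; exact Finset.mem_biUnion.2 ⟨j, Finset.mem_univ _, ha⟩)

theorem termFun_relabel {L : FirstOrder.Language.{u, v}} {β γ : Type*} (g : β → γ)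
    (t : L.Term β) : termFun (t.relabel g) = termFun t := by
  induction t with
  | var => rfl
  | func f ts ih => simp only [Term.relabel, termFun, ih]

/-! ### Abstraction of foreign subterms by names -/

section Skeleton

variable {L : FirstOrder.Language.{u, v}} {α : Type w} {N : Type z}

open Classical in
/-- The term in which the maximal subterms that start with a function outside of `Φ` or are a
variable outside of `V` are replaced by names. -/
noncomputable def skeleton (Φ : Set (Σ k, L.Functions k)) (V : Set α) :
    L.Term (α ⊕ N) → L.Term (α ⊕ L.Term (α ⊕ N))
  | .var (.inl a) => if a ∈ V then .var (.inl a) else .var (.inr (.var (.inl a)))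
  | .var (.inr b) => .var (.inr (.var (.inr b)))
  | .func (l := l) f ts => if (⟨l, f⟩ : Σ k, L.Functions k) ∈ Φ then
      .func f fun j => skeleton Φ V (ts j) else .var (.inr (.func f ts))

variable (Φ : Set (Σ k, L.Functions k)) (V : Set α)

/-- Interpreting each name by the value of the term that it stands for undoes the abstraction. -/
theorem realize_skeleton [L.Structure N] (y : α → N) (t : L.Term (α ⊕ N)) :
    (skeleton Φ V t).realize (Sum.elim y fun s => s.realize (Sum.elim y id)) =
      t.realize (Sum.elim y id) := by
  induction t with
  | var b =>
    rcases b with a | b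
    · rw [skeleton]; split_ifs <;> rfl
    · rfl
  | func f ts ih =>
    rw [skeleton]
    split_ifs
    · simp only [Term.realize, ih]
    · rfl

theorem termFun_skeleton (t : L.Term (α ⊕ N)) : termFun (skeleton Φ V t) ⊆ Φ := by
  induction t with
  | var b =>
    rcases b with a | b
    · rw [skeleton]; split_ifs <;> exact Set.empty_subset _
    · exact Set.empty_subset _
  | func f ts ih =>
    rw [skeleton]
    split_ifs with h
    · exact Set.union_subset (Set.singleton_subset_iff.2 h) (Set.iUnion_subset ih)
    · exact Set.empty_subset _

theorem varFinsetLeft_skeleton [DecidableEq α] {γ : Type*} (g : L.Term (α ⊕ N) → γ)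
    (t : L.Term (α ⊕ N)) {a : α}
    (ha : a ∈ ((skeleton Φ V t).relabel (Sum.map id g)).varFinsetLeft) : a ∈ V := by
  induction t with
  | var b =>
    rcases b with a | b
    · rw [skeleton] at ha
      split_ifs at ha with h
      · simp only [Term.relabel, Sum.map_inl, id, Term.varFinsetLeft, Finset.mem_singleton] at ha
        exact ha ▸ h
      · simp [Term.relabel, Term.varFinsetLeft] at ha
    · simp [skeleton, Term.relabel, Term.varFinsetLeft] at ha
  | func f ts ih =>
    rw [skeleton] at ha
    split_ifs at ha with h
    · simp only [Term.relabel, Term.varFinsetLeft, Finset.mem_biUnion] at ha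
      obtain ⟨j, -, hj⟩ := ha
      exact ih j hj
    · simp [Term.relabel, Term.varFinsetLeft] at ha

end Skeleton

/-! ### Existence of universal Craig-Lyndon interpolants -/

section Interpolation

variable {L : FirstOrder.Language.{u, v}} {α : Type w} [DecidableEq α]

/-- `H` is a universal consequence of `A` in the vocabulary common to `A` and `B`, for `A` whose
functions all occur in `B`. -/
structure IsUniversalConsequence (A B H : L.Formula α) : Prop where
  universal : Universal H
  eqFree : EqFree H
  entails : Entails A H
  predPol : PredPol H ⊆ PredPol A ∩ PredPol B
  func : Fun H ⊆ Fun A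
  freeVar : H.freeVarFinset ⊆ A.freeVarFinset

theorem IsUniversalConsequence.top (A B : L.Formula α) : IsUniversalConsequence A B ⊤ where
  universal := ⟨trivial, trivial⟩
  eqFree := ⟨trivial, trivial⟩
  entails := entails_iff.2 fun _ _ _ _ _ => id
  predPol := Set.union_subset (Set.empty_subset _) (Set.empty_subset _)
  func := Set.union_subset (Set.empty_subset _) (Set.empty_subset _)
  freeVar := Finset.union_subset (Finset.empty_subset _) (Finset.empty_subset _)

theorem IsUniversalConsequence.inf {A B H K : L.Formula α} (hH : IsUniversalConsequence A B H)
    (hK : IsUniversalConsequence A B K) : IsUniversalConsequence A B (H ⊓ K) where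
  universal := univAux_inf.2 ⟨hH.universal, hK.universal⟩
  eqFree := eqFree_inf.2 ⟨hH.eqFree, hK.eqFree⟩
  entails := entails_iff.2 fun M _ _ x hx => Formula.realize_inf.2
    ⟨entails_iff.1 hH.entails M x hx, entails_iff.1 hK.entails M x hx⟩
  predPol := by
    rw [PredPol, predPolAux_inf]
    exact Set.union_subset hH.predPol hK.predPol
  func := by
    rw [fun_inf]
    exact Set.union_subset hH.func hK.func
  freeVar := by
    rw [freeVarFinset_inf]
    exact Finset.union_subset hH.freeVar hK.freeVar

variable {A B : L.Formula α}

/-- The terms with constants from the domain of a structure. -/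
abbrev TermDomain (L : FirstOrder.Language.{u, v}) (α : Type w) (N : Type z) := L.Term (α ⊕ N)

/-- The atoms, with signs, over the common vocabulary of `A` and `B` that are to be refuted. -/
structure DiagramAtom (A B : L.Formula α) (N : Type z) [L.Structure N] (y : α → N) where
  /-- The polarity. -/
  sign : Bool
  /-- The arity. -/
  arity : ℕ
  /-- The predicate. -/
  rel : L.Relations arity
  /-- The arguments. -/
  args : Fin arity → TermDomain L α N
  mem : (sign, (⟨arity, rel⟩ : Σ k, L.Relations k)) ∈ PredPol A ∩ PredPol B
  holds : if sign then ¬ Structure.RelMap rel (fun j => (args j).realize (Sum.elim y id))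
    else Structure.RelMap rel (fun j => (args j).realize (Sum.elim y id))

variable {N : Type (max u v w)} [L.Structure N] [Nonempty N] {y : α → N}

/-- The skeleton of a term with respect to the functions and free variables of `A`. -/
noncomputable abbrev skel (A : L.Formula α) (t : TermDomain L α N) :
    L.Term (α ⊕ TermDomain L α N) := skeleton (Fun A) (A.freeVarFinset : Set α) t

/-- If A contradicts finitely many diagram literals, the names in them are arbitrary elements, so A
entails the universal closure of the disjunction of the complements. Taking skeletons keeps it in
the functions and free variables of A, and complementing gives each predicate the recorded sign. It
fails in N because the literals hold there. -/
theorem exists_universalConsequence_refuting (s : Finset (DiagramAtom A B N y))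
    (hs : ∀ (M : Type (max u v w)) [L.Structure M] [Nonempty M] (m : α ⊕ TermDomain L α N → M),
      A.Realize (m ∘ Sum.inl) → ¬ ∀ j ∈ s, if j.sign then
        ¬ Structure.RelMap j.rel fun i => (skel A (j.args i)).realize m
        else Structure.RelMap j.rel fun i => (skel A (j.args i)).realize m) :
    ∃ H, IsUniversalConsequence A B H ∧ ¬ H.Realize y := by
  classical
  have : Nonempty (TermDomain L α N) := ⟨.var (.inr (Classical.arbitrary N))⟩
  obtain ⟨k, idx, back, hback⟩ := exists_names (D := TermDomain L α N)
    (s.biUnion fun j => Finset.univ.biUnion fun i => (skel A (j.args i)).varFinset.toRight)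
  let lit : DiagramAtom A B N y → L.BoundedFormula α k := fun j => negLiteral j.sign j.rel
    fun i => (skel A (j.args i)).relabel (Sum.map id idx)
  have hlit : ∀ (j) (M : Type (max u v w)) [L.Structure M] (x : α → M) (xs : Fin k → M),
      (lit j).Realize x xs ↔ if j.sign then
        ¬ Structure.RelMap j.rel fun i => (skel A (j.args i)).realize (Sum.elim x (xs ∘ idx))
        else Structure.RelMap j.rel fun i =>
          (skel A (j.args i)).realize (Sum.elim x (xs ∘ idx)) := by
    intro j M _ x xs
    simp only [lit, realize_negLiteral, Term.realize_relabel, Sum.elim_comp_map,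
      Function.comp_id]
  refine ⟨(refute (s.toList.map lit)).alls, ⟨?_, ?_, ?_, ?_, ?_, ?_⟩, ?_⟩
  · refine univAux_alls.2 (refute_induction trivial fun f hf K hK => ⟨?_, hK⟩)
    obtain ⟨j, -, rfl⟩ := List.mem_map.1 hf
    simp only [lit, negLiteral]
    split_ifs <;> simp [univAux]
  · refine eqFree_alls.2 (refute_induction trivial fun f hf K hK => ⟨?_, hK⟩)
    obtain ⟨j, -, rfl⟩ := List.mem_map.1 hf
    simp only [lit, negLiteral]
    split_ifs <;> simp [EqFree]
  · rw [entails_iff]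
    intro M _ _ x hx
    refine BoundedFormula.realize_alls.2 fun xs => realize_refute.2 fun h => ?_
    refine hs M (Sum.elim x (xs ∘ idx)) hx fun j hj => ?_
    exact (hlit j M x xs).1 (h _ (List.mem_map.2 ⟨j, Finset.mem_toList.2 hj, rfl⟩))
  · rw [PredPol, predPolAux_alls]
    refine refute_induction (P := fun K => predPolAux true K ⊆ _) (Set.empty_subset _)
      fun f hf K hK => Set.union_subset ?_ hK
    obtain ⟨⟨sgn, l, R, ts, hm, hh⟩, -, rfl⟩ := List.mem_map.1 hf
    simp only [lit, negLiteral]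
    cases sgn <;> simpa [predPolAux] using! hm
  · rw [fun_alls]
    refine refute_induction (P := fun K => Fun K ⊆ _) (Set.empty_subset _)
      fun f hf K hK => Set.union_subset ?_ hK
    obtain ⟨j, -, rfl⟩ := List.mem_map.1 hf
    have : (⋃ i, termFun ((skel A (j.args i)).relabel (Sum.map id idx))) ⊆ Fun A := by
      refine Set.iUnion_subset fun i => ?_
      rw [termFun_relabel]
      exact termFun_skeleton _ _ _
    simp only [lit, negLiteral]
    split_ifs <;> simpa [Fun] using! this
  · rw [freeVarFinset_alls]
    refine refute_induction (P := fun K => K.freeVarFinset ⊆ _) (Finset.empty_subset _)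
      fun f hf K hK => Finset.union_subset ?_ hK
    obtain ⟨j, -, rfl⟩ := List.mem_map.1 hf
    have : (Finset.univ.biUnion fun i =>
        ((skel A (j.args i)).relabel (Sum.map id idx)).varFinsetLeft) ⊆ A.freeVarFinset := by
      refine Finset.biUnion_subset.2 fun i _ a ha => ?_
      exact varFinsetLeft_skeleton _ _ _ _ ha
    simp only [lit, negLiteral]
    split_ifs <;> simpa [BoundedFormula.freeVarFinset] using! this
  · intro h
    -- The counterexample in N: each variable takes the value of the term that it names.
    have := realize_refute.1 (BoundedFormula.realize_alls.1 h
      fun i => (back i).realize (Sum.elim y id))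
    refine this fun f hf => ?_
    obtain ⟨j, hj, rfl⟩ := List.mem_map.1 hf
    rw [hlit]
    have key : ∀ i, (skel A (j.args i)).realize
        (Sum.elim y ((fun i => (back i).realize (Sum.elim y id)) ∘ idx)) =
          (j.args i).realize (Sum.elim y id) := by
      intro i
      rw [← realize_skeleton (Fun A) (A.freeVarFinset : Set α) y (j.args i)]
      refine realize_congr_varFinset _ fun b hb => ?_
      rcases b with a | d
      · rfl
      · simp only [Sum.elim_inr, Function.comp_apply]
        rw [hback d]
        exact Finset.mem_biUnion.2 ⟨j, Finset.mem_toList.1 hj, Finset.mem_biUnion.2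
          ⟨i, Finset.mem_univ _, Finset.mem_toRight.2 hb⟩⟩
    simp only [key]
    exact j.holds

/-- If the diagram and `A` have a common model, then `A` and the negation of `B` have one. -/
theorem not_entails_of_diagram (hA : EqFree A) (hB : EqFree B) (hU : Universal A)
    (hy : ¬ B.Realize y) {M : Type (max u v w)} [L.Structure M]
    (m : α ⊕ TermDomain L α N → M) (hm : A.Realize (m ∘ Sum.inl))
    (hd : ∀ j : DiagramAtom A B N y, if j.sign then
        ¬ Structure.RelMap j.rel fun i => (skel A (j.args i)).realize m
        else Structure.RelMap j.rel fun i => (skel A (j.args i)).realize m) :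
    ¬ Entails A B := by
  let h : TermDomain L α N → M := fun t => (skel A t).realize m
  let ev : TermDomain L α N → N := fun t => t.realize (Sum.elim y id)
  -- Functions act freely. A relation holds only when forced: by M if A needs it positively, or by N
  -- if B needs it negatively. The diagram reconciles the two when both signs matter.
  let _ : L.Structure (TermDomain L α N) :=
    { funMap := fun f ts => .func f ts
      RelMap := fun {k} R ts =>
        ((true, ⟨k, R⟩) ∈ PredPol A ∧ Structure.RelMap R (h ∘ ts)) ∨
        ((false, ⟨k, R⟩) ∈ PredPol B ∧ Structure.RelMap R (ev ∘ ts)) }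
  have : Nonempty (TermDomain L α N) := ⟨.var (.inr (Classical.arbitrary N))⟩
  have hdiag : ∀ (s : Bool) (k : ℕ) (R : L.Relations k),
      (s, (⟨k, R⟩ : Σ k, L.Relations k)) ∈ PredPol A → (s, ⟨k, R⟩) ∈ PredPol B →
      ∀ ts : Fin k → TermDomain L α N,
      (if s then ¬ Structure.RelMap R (ev ∘ ts) else Structure.RelMap R (ev ∘ ts)) →
      if s then ¬ Structure.RelMap R (h ∘ ts) else Structure.RelMap R (h ∘ ts) :=
    fun s k R h1 h2 ts h3 => hd ⟨s, k, R, ts, ⟨h1, h2⟩, h3⟩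
  intro hAB
  let x : α → TermDomain L α N := fun a => .var (.inl a)
  have hAx : A.Realize x := by
    -- Pull A back from M: universality replaces surjectivity of `h`, and `h` commutes with the
    -- functions of A because skeletons descend through exactly these.
    refine (realize_transfer h true A hA (.inl hU) (fun k f hf ts => ?_) ?_ ?_ x _).1 rfl ?_
    · change (skel A (.func f ts)).realize m = _
      rw [skel, skeleton, if_pos hf, Term.realize]
      rfl
    · exact fun k R hR ts hr => .inl ⟨hR, hr⟩
    · rintro k R hR ts (⟨-, hr⟩ | ⟨hR', hr⟩)
      · exact hr
      -- The relation was forced by N; the diagram carries this positive fact over to M.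
      · exact hdiag false k R hR hR' ts hr
    · refine (realize_congr_freeVar A (fun a ha => ?_) _).1
        (Formula.boundedFormula_realize_eq_realize A _ _ |>.2 hm)
      change m (.inl a) = (skel A (.var (.inl a))).realize m
      rw [skel, skeleton, if_pos (by exact ha), Term.realize]
  have hBx := entails_iff.1 hAB _ x hAx
  -- Every element of N is itself a term, so B may contain arbitrary quantifiers.
  have hsurj : Function.Surjective ev := fun b => ⟨.var (.inr b), rfl⟩
  refine hy ((Formula.boundedFormula_realize_eq_realize B _ _).1
    ((realize_transfer ev false B hB (.inr hsurj) (fun k f hf ts => rfl) ?_ ?_ x _).2 rfl hBx))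
  · intro k R hR ts hr
    exact .inr ⟨(mem_predPolAux_not true true B _).1 hR, hr⟩
  · intro k R hR ts hr
    have hR' := (mem_predPolAux_not true false B _).1 hR
    rcases hr with ⟨hR'', hr⟩ | ⟨-, hr⟩
    · by_contra hn
      -- If the relation, forced by M, failed in N, the diagram would make it fail in M.
      exact hdiag true k R hR'' hR' ts hn hr
    · exact hr

/-- Two applications of compactness: one reduces the claim to entailment of B by all universal
consequences in the common vocabulary, the other builds the model M of A and the diagram of a
putative counterexample N. -/
theorem exists_universal_interpolant (hA : EqFree A) (hB : EqFree B) (hU : Universal A)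
    (hfun : Fun A ⊆ Fun B) (h : Entails A B) :
    ∃ H, Universal H ∧ IsCraigLyndonInterpolant A B H ∧
      H.freeVarFinset ⊆ A.freeVarFinset := by
  classical
  obtain ⟨s, hs⟩ : ∃ s : Finset {H // IsUniversalConsequence A B H},
      ∀ (M : Type (max u v w)) [L.Structure M] [Nonempty M] (x : α → M),
        (∀ H ∈ s, H.1.Realize x) → B.Realize x := by
    by_contra! hno
    obtain ⟨N, _, _, y, hy, hH⟩ := exists_realize_of_finite.{u, v, w, max u v w, max u v w} B.not
      (fun H : {H // IsUniversalConsequence A B H} => H.1) fun s => by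
        obtain ⟨M, I, hne, x, h1, h2⟩ := hno s
        exact ⟨M, I, hne, x, Formula.realize_not.2 h2, h1⟩
    -- Names become additional free variables. A finite inconsistent part of the diagram would yield
    -- a universal consequence that is false in N, contrary to `hH`.
    obtain ⟨M, _, _, m, hm, hd⟩ := exists_realize_of_finite
      (A.relabel (Sum.inl : α → α ⊕ TermDomain L α N))
      (fun j : DiagramAtom A B N y => (negLiteral j.sign j.rel
        (fun i => (skel A (j.args i)).relabel Sum.inl) :
          L.BoundedFormula (α ⊕ TermDomain L α N) 0)) fun s => by
        by_contra! hno
        obtain ⟨H, hH1, hH2⟩ := exists_universalConsequence_refuting s fun M _ _ m hm hj => by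
          obtain ⟨j, hj1, hj2⟩ := hno M _ inferInstance m (Formula.realize_relabel.2 hm)
          refine hj2 (realize_negLiteral.2 ?_)
          simp only [Term.realize_relabel, Sum.elim_comp_inl]
          exact hj j hj1
        exact hH2 (hH ⟨H, hH1⟩)
    refine not_entails_of_diagram hA hB hU (Formula.realize_not.1 hy) m
      (Formula.realize_relabel.1 hm) (fun j => ?_) h
    have := realize_negLiteral.1 (hd j)
    simpa only [Term.realize_relabel, Sum.elim_comp_inl] using this
  obtain ⟨H, hH, hHs⟩ : ∃ H, IsUniversalConsequence A B H ∧
      ∀ (M : Type (max u v w)) [L.Structure M] [Nonempty M] (x : α → M),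
        H.Realize x → ∀ K ∈ s, K.1.Realize x := by
    clear hs
    induction s using Finset.induction_on with
    | empty => exact ⟨⊤, .top A B, by simp⟩
    | insert K s _ ih =>
      obtain ⟨H, hH, hHs⟩ := ih
      refine ⟨K.1 ⊓ H, K.2.inf hH, fun M _ _ x hx => ?_⟩
      rw [Formula.realize_inf] at hx
      exact (Finset.forall_mem_insert _ _ _).2 ⟨hx.1, hHs M x hx.2⟩
  exact ⟨H, hH.universal, ⟨hH.eqFree, hH.entails,
    entails_iff.2 fun M _ _ x hx => hs M x (hHs M x hx), hH.predPol,
    fun f hf => ⟨hH.func hf, hfun (hH.func hf)⟩⟩, hH.freeVar⟩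

end Interpolation

end LPInterpolation

namespace LPInterpolation

open Language

/-! ### Syntactic operations on Gödel numbers -/

/-- The code of the conjunction of formulas with given codes. -/
def infCode (a b : ℕ) : ℕ :=
  Nat.pair 3 (Nat.pair (Nat.pair 3 (Nat.pair a (Nat.pair 3 (Nat.pair b 0)))) 0)

/-- The leaves of a formula code `c` (and the codes of its universally quantified subformulas), each
with its polarity and the number of bound variables in scope, where `c` itself occurs with
polarity `s` in the scope of `n` bound variables. The argument is `(s, n, c)`. -/
def leaves (p : Bool × ℕ × ℕ) : List (Bool × ℕ × ℕ) :=
  if _ : p.2.2.unpair.1 = 3 then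
    leaves (!p.1, p.2.1, p.2.2.unpair.2.unpair.1) ++ leaves (p.1, p.2.1, p.2.2.unpair.2.unpair.2)
  else if _ : p.2.2.unpair.1 = 4 then p :: leaves (p.1, p.2.1 + 1, p.2.2.unpair.2)
  else [p]
termination_by p.2.2
decreasing_by
  · exact left_lt (by omega)
  · exact right_lt (by omega)
  · exact unpair_snd_lt (by omega)

theorem leaves_imp (s : Bool) (n a b : ℕ) : leaves (s, n, Nat.pair 3 (Nat.pair a b)) =
    leaves (!s, n, a) ++ leaves (s, n, b) := by
  rw [leaves]; simp

theorem leaves_all (s : Bool) (n a : ℕ) : leaves (s, n, Nat.pair 4 a) =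
    (s, n, Nat.pair 4 a) :: leaves (s, n + 1, a) := by
  rw [leaves]; simp

theorem leaves_of_ne {s : Bool} {n c : ℕ} (h3 : c.unpair.1 ≠ 3) (h4 : c.unpair.1 ≠ 4) :
    leaves (s, n, c) = [(s, n, c)] := by
  rw [leaves, dif_neg h3, dif_neg h4]

theorem leaves_zero (s : Bool) (n : ℕ) : leaves (s, n, 0) = [(s, n, 0)] :=
  leaves_of_ne (by simp) (by simp)

/-- The symbols (variables and functions) of a term code. -/
def termSyms (t : ℕ) : List ℕ :=
  if t.unpair.1 = 2 then
    -- The symbol records both the claimed arity and the actual number of arguments; comparison with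
    -- `funSym` thus rejects ill-formed terms.
    Nat.pair 2 (Nat.pair t.unpair.2.unpair.1 (Nat.pair t.unpair.2.unpair.2.unpair.1
      (termArgs t).length)) :: ((termArgs t).attach.map fun s => termSyms s.1).flatten
  else [t]
termination_by t
decreasing_by exact mem_termArgs_lt s.2

theorem termSyms_eq (t : ℕ) : termSyms t =
    if t.unpair.1 = 2 then
      Nat.pair 2 (Nat.pair t.unpair.2.unpair.1 (Nat.pair t.unpair.2.unpair.2.unpair.1
        (termArgs t).length)) :: ((termArgs t).map fun s => termSyms s).flatten
    else [t] := by
  rw [termSyms, List.attach_map_val (f := fun s => termSyms s)]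

/-- The symbols of the terms of an atom code. -/
def leafSyms (c : ℕ) : List ℕ :=
  if c.unpair.1 = 2 then (termArgs c).flatMap termSyms else []

/-- The arity and the predicate of an atom code. -/
def relSym (c : ℕ) : ℕ := Nat.pair c.unpair.2.unpair.1 c.unpair.2.unpair.2.unpair.1

/-- The predicate with code `r` occurs with polarity `s` in the formula with code `c`. -/
def HasRel (c : ℕ) (s : Bool) (r : ℕ) : Prop :=
  ∃ p ∈ leaves (true, 0, c), p.1 = s ∧ p.2.2.unpair.1 = 2 ∧ relSym p.2.2 = r

/-- The symbol `y` occurs in the formula with code `c`. -/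
def HasSym (c : ℕ) (y : ℕ) : Prop := ∃ p ∈ leaves (true, 0, c), y ∈ leafSyms p.2.2

/-- The leaf is well-formed with predicates from `P` and symbols from `Y`, or it is a quantified
formula with positive polarity. -/
def LeafOk (P : Bool → ℕ → Prop) (Y : ℕ → Prop) (p : Bool × ℕ × ℕ) : Prop :=
  p.2.2 = 0 ∨ (p.2.2.unpair.1 = 4 ∧ p.1 = true) ∨
    (p.2.2.unpair.1 = 2 ∧ P p.1 (relSym p.2.2) ∧
      (termArgs p.2.2).length = p.2.2.unpair.2.unpair.1 ∧
      -- Bound variables must lie in scope. Every other symbol must come from the vocabulary, which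
      -- also excludes numbers that are not term codes.
      ∀ y ∈ leafSyms p.2.2, (y.unpair.1 = 1 ∧ y.unpair.2 < p.2.1) ∨ (y.unpair.1 ≠ 1 ∧ Y y))

/-- The code of `∀ x, p⁰(x) → p¹(x)` for the pair `q` of an arity and a code of `p`. -/
def zeroImpOneCode (q : ℕ) : ℕ :=
  (Nat.pair 4)^[q.unpair.1] (Nat.pair 3 (Nat.pair
    (Nat.pair 2 (Nat.pair q.unpair.1 (Nat.pair (Nat.pair q.unpair.2 0)
      (Encodable.encode ((List.range q.unpair.1).map (Nat.pair 1))))))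
    (Nat.pair 2 (Nat.pair q.unpair.1 (Nat.pair (Nat.pair q.unpair.2 1)
      (Encodable.encode ((List.range q.unpair.1).map (Nat.pair 1))))))))

/-- The arities and codes of the predicates of the formula with code `c`, without superscripts. -/
def predLPCode (p : Bool × ℕ × ℕ) : List ℕ :=
  (leaves p).filterMap fun q => if q.2.2.unpair.1 = 2 then
    some (Nat.pair (relSym q.2.2).unpair.1 (relSym q.2.2).unpair.2.unpair.1) else none

/-- The code of `S F`. -/
def SCode (c : ℕ) : ℕ :=
  (predLPCode (true, 0, c)).foldr (fun q K => infCode (zeroImpOneCode q) K)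
    (Nat.pair 3 (Nat.pair 0 0))

/-- The code of `rename01 F`. -/
def renameCode (c : ℕ) : ℕ :=
  if _ : c.unpair.1 = 3 then
    Nat.pair 3 (Nat.pair (renameCode c.unpair.2.unpair.1) (renameCode c.unpair.2.unpair.2))
  else if _ : c.unpair.1 = 4 then Nat.pair 4 (renameCode c.unpair.2)
  else if c.unpair.1 = 2 then
    Nat.pair 2 (Nat.pair c.unpair.2.unpair.1 (Nat.pair
      (Nat.pair c.unpair.2.unpair.2.unpair.1.unpair.1 1) c.unpair.2.unpair.2.unpair.2))
  else c
termination_by c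
decreasing_by
  · exact left_lt (by omega)
  · exact right_lt (by omega)
  · exact unpair_snd_lt (by omega)

/-! ### Primitive recursiveness -/

theorem primrec_infCode : Primrec₂ infCode := by
  have h3 := fun {f : ℕ × ℕ → ℕ} (hf : Primrec f) => Primrec₂.natPair.comp (.const 3) hf
  exact h3 (Primrec₂.natPair.comp (h3 (Primrec₂.natPair.comp Primrec.fst
    (h3 (Primrec₂.natPair.comp Primrec.snd (.const 0))))) (.const 0))

theorem primrec_leaves : Primrec leaves := by
  have htag : Primrec fun p : Bool × ℕ × ℕ => p.2.2.unpair.1 :=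
    primrec_unpair_fst.comp (Primrec.snd.comp Primrec.snd)
  have harg : Primrec fun p : Bool × ℕ × ℕ => p.2.2.unpair.2 :=
    primrec_unpair_snd.comp (Primrec.snd.comp Primrec.snd)
  have hs : Primrec fun p : Bool × ℕ × ℕ => p.1 := Primrec.fst
  have hn : Primrec fun p : Bool × ℕ × ℕ => p.2.1 := Primrec.fst.comp Primrec.snd
  refine Primrec.nat_omega_rec' leaves (m := fun p => p.2.2)
    (l := fun p => if p.2.2.unpair.1 = 3 then
        [(!p.1, p.2.1, p.2.2.unpair.2.unpair.1), (p.1, p.2.1, p.2.2.unpair.2.unpair.2)]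
      else if p.2.2.unpair.1 = 4 then [(p.1, p.2.1 + 1, p.2.2.unpair.2)] else [])
    (g := fun p r => some (if p.2.2.unpair.1 = 4 then p :: r.flatten
      else if p.2.2.unpair.1 = 3 then r.flatten else [p]))
    (Primrec.snd.comp Primrec.snd) ?_ ?_ ?_ ?_
  · refine .ite (Primrec.eq.comp htag (.const 3)) ?_
      (.ite (Primrec.eq.comp htag (.const 4)) ?_ (.const []))
    · exact Primrec.list_cons.comp (.pair (Primrec.not.comp hs) (.pair hn
        (primrec_unpair_fst.comp harg))) (Primrec.list_cons.comp (.pair hs (.pair hn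
        (primrec_unpair_snd.comp harg))) (.const []))
    · exact Primrec.list_cons.comp (.pair hs (.pair (Primrec.succ.comp hn) harg)) (.const [])
  · have hr : Primrec fun q : (Bool × ℕ × ℕ) × List (List (Bool × ℕ × ℕ)) => q.2.flatten :=
      Primrec.list_flatten.comp Primrec.snd
    exact Primrec.option_some.comp (.ite (Primrec.eq.comp (htag.comp Primrec.fst) (.const 4))
      (Primrec.list_cons.comp Primrec.fst hr)
      (.ite (Primrec.eq.comp (htag.comp Primrec.fst) (.const 3)) hr
        (Primrec.list_cons.comp Primrec.fst (.const []))))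
  · intro p q hq
    split_ifs at hq with h3 h4
    · simp only [List.mem_cons, List.not_mem_nil, or_false] at hq
      rcases hq with rfl | rfl
      · exact left_lt (by omega)
      · exact right_lt (by omega)
    · simp only [List.mem_cons, List.not_mem_nil, or_false] at hq
      subst hq
      exact unpair_snd_lt (by omega)
    · simp at hq
  · intro p
    rw [leaves]
    split_ifs <;> first | omega | simp

theorem primrec_termSyms : Primrec termSyms := by
  refine Primrec.nat_omega_rec' termSyms (m := id) (l := termArgs)
    (g := fun t r => some (if t.unpair.1 = 2 then
      Nat.pair 2 (Nat.pair t.unpair.2.unpair.1 (Nat.pair t.unpair.2.unpair.2.unpair.1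
        (termArgs t).length)) :: r.flatten
      else [t])) Primrec.id primrec_termArgs ?_ (fun _ _ h => mem_termArgs_lt h)
      (fun t => by rw [← termSyms_eq])
  have harg : Primrec fun q : ℕ × List (List ℕ) => q.1.unpair.2 :=
    primrec_unpair_snd.comp Primrec.fst
  refine Primrec.option_some.comp (.ite (Primrec.eq.comp
    (primrec_unpair_fst.comp Primrec.fst) (.const 2)) (Primrec.list_cons.comp ?_
      (Primrec.list_flatten.comp Primrec.snd)) (Primrec.list_cons.comp Primrec.fst (.const [])))
  exact Primrec₂.natPair.comp (.const 2) (Primrec₂.natPair.comp (primrec_unpair_fst.comp harg)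
    (Primrec₂.natPair.comp (primrec_unpair_fst.comp (primrec_unpair_snd.comp harg))
      (Primrec.list_length.comp (primrec_termArgs.comp Primrec.fst))))

theorem primrec_leafSyms : Primrec leafSyms :=
  .ite (Primrec.eq.comp primrec_unpair_fst (.const 2))
    (Primrec.list_flatMap primrec_termArgs (primrec_termSyms.comp Primrec.snd)) (.const [])

theorem primrec_relSym : Primrec relSym :=
  Primrec₂.natPair.comp (primrec_unpair_fst.comp primrec_unpair_snd)
    (primrec_unpair_fst.comp (primrec_unpair_snd.comp primrec_unpair_snd))

theorem primrecPred_hasRel : PrimrecPred fun q : ℕ × Bool × ℕ => HasRel q.1 q.2.1 q.2.2 := by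
  have h : PrimrecRel fun (p : Bool × ℕ × ℕ) (q : ℕ × Bool × ℕ) =>
      p.1 = q.2.1 ∧ p.2.2.unpair.1 = 2 ∧ relSym p.2.2 = q.2.2 := by
    have hc : Primrec fun x : (Bool × ℕ × ℕ) × (ℕ × Bool × ℕ) => x.1.2.2 :=
      Primrec.snd.comp (Primrec.snd.comp Primrec.fst)
    exact (Primrec.eq.comp (Primrec.fst.comp Primrec.fst)
      (Primrec.fst.comp (Primrec.snd.comp Primrec.snd))).and
      ((Primrec.eq.comp (primrec_unpair_fst.comp hc) (.const 2)).and
        (Primrec.eq.comp (primrec_relSym.comp hc)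
          (Primrec.snd.comp (Primrec.snd.comp Primrec.snd))))
  exact h.exists_mem_list.comp (primrec_leaves.comp (.pair (.const true)
    (.pair (.const 0) Primrec.fst))) Primrec.id

theorem primrecPred_hasRel_comp {β : Type*} [Primcodable β] {f : β → ℕ} {g : β → Bool} {h : β → ℕ}
    (hf : Primrec f) (hg : Primrec g) (hh : Primrec h) :
    PrimrecPred fun x => HasRel (f x) (g x) (h x) :=
  primrecPred_hasRel.comp (hf.pair (hg.pair hh))

theorem primrecRel_hasSym : PrimrecRel HasSym := by
  have h1 : PrimrecRel fun (x y : ℕ) => x = y := Primrec.eq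
  have h2 : PrimrecRel fun (p : Bool × ℕ × ℕ) (y : ℕ) => ∃ x ∈ leafSyms p.2.2, x = y :=
    h1.exists_mem_list.comp (primrec_leafSyms.comp (Primrec.snd.comp
      (Primrec.snd.comp Primrec.fst))) Primrec.snd
  have h3 := h2.exists_mem_list.comp (f := fun q : ℕ × ℕ => leaves (true, 0, q.1))
    (primrec_leaves.comp (.pair (.const true) (.pair (.const 0) Primrec.fst))) Primrec.snd
  exact h3.of_eq fun q => by simp [HasSym]

/-- Every leaf of the formula with code `c` is well-formed with predicates common to the formulas
with codes `a` and `b` and symbols of the formula with code `a`. -/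
def Admissible (a b c : ℕ) : Prop :=
  ∀ p ∈ leaves (true, 0, c), LeafOk (fun s r => HasRel a s r ∧ HasRel b s r) (HasSym a) p

theorem primrecPred_admissible :
    PrimrecPred fun q : ℕ × ℕ × ℕ => Admissible q.1 q.2.1 q.2.2 := by
  have h1 : PrimrecRel fun (y : ℕ) (q : ℕ × ℕ) =>
      (y.unpair.1 = 1 ∧ y.unpair.2 < q.1) ∨ (y.unpair.1 ≠ 1 ∧ HasSym q.2 y) := by
    have htag : PrimrecPred fun x : ℕ × ℕ × ℕ => x.1.unpair.1 = 1 :=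
      Primrec.eq.comp (primrec_unpair_fst.comp Primrec.fst) (.const 1)
    exact (htag.and (Primrec.nat_lt.comp (primrec_unpair_snd.comp Primrec.fst)
      (Primrec.fst.comp Primrec.snd))).or (htag.not.and (primrecRel_hasSym.comp
        (Primrec.snd.comp Primrec.snd) Primrec.fst))
  have h2 : PrimrecRel fun (p : Bool × ℕ × ℕ) (q : ℕ × ℕ × ℕ) =>
      LeafOk (fun s r => HasRel q.1 s r ∧ HasRel q.2.1 s r) (HasSym q.1) p := by
    have hs : Primrec fun x : (Bool × ℕ × ℕ) × (ℕ × ℕ × ℕ) => x.1.1 :=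
      Primrec.fst.comp Primrec.fst
    have hd : Primrec fun x : (Bool × ℕ × ℕ) × (ℕ × ℕ × ℕ) => x.1.2.1 :=
      Primrec.fst.comp (Primrec.snd.comp Primrec.fst)
    have hc : Primrec fun x : (Bool × ℕ × ℕ) × (ℕ × ℕ × ℕ) => x.1.2.2 :=
      Primrec.snd.comp (Primrec.snd.comp Primrec.fst)
    have ha : Primrec fun x : (Bool × ℕ × ℕ) × (ℕ × ℕ × ℕ) => x.2.1 :=
      Primrec.fst.comp Primrec.snd
    have hb : Primrec fun x : (Bool × ℕ × ℕ) × (ℕ × ℕ × ℕ) => x.2.2.1 :=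
      Primrec.fst.comp (Primrec.snd.comp Primrec.snd)
    have e1 : PrimrecPred fun x : (Bool × ℕ × ℕ) × (ℕ × ℕ × ℕ) => x.1.2.2 = 0 :=
      Primrec.eq.comp hc (.const 0)
    have e2 : PrimrecPred fun x : (Bool × ℕ × ℕ) × (ℕ × ℕ × ℕ) => x.1.2.2.unpair.1 = 4 :=
      Primrec.eq.comp (primrec_unpair_fst.comp hc) (.const 4)
    have e3 : PrimrecPred fun x : (Bool × ℕ × ℕ) × (ℕ × ℕ × ℕ) => x.1.1 = true :=
      Primrec.eq.comp hs (.const true)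
    have e4 : PrimrecPred fun x : (Bool × ℕ × ℕ) × (ℕ × ℕ × ℕ) => x.1.2.2.unpair.1 = 2 :=
      Primrec.eq.comp (primrec_unpair_fst.comp hc) (.const 2)
    have e5 : PrimrecPred fun x : (Bool × ℕ × ℕ) × (ℕ × ℕ × ℕ) =>
        HasRel x.2.1 x.1.1 (relSym x.1.2.2) :=
      primrecPred_hasRel_comp ha hs (primrec_relSym.comp hc)
    have e6 : PrimrecPred fun x : (Bool × ℕ × ℕ) × (ℕ × ℕ × ℕ) =>
        HasRel x.2.2.1 x.1.1 (relSym x.1.2.2) :=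
      primrecPred_hasRel_comp hb hs (primrec_relSym.comp hc)
    have e7 : PrimrecPred fun x : (Bool × ℕ × ℕ) × (ℕ × ℕ × ℕ) =>
        (termArgs x.1.2.2).length = x.1.2.2.unpair.2.unpair.1 :=
      Primrec.eq.comp (Primrec.list_length.comp (primrec_termArgs.comp hc))
        (primrec_unpair_fst.comp (primrec_unpair_snd.comp hc))
    have e8 : PrimrecPred fun x : (Bool × ℕ × ℕ) × (ℕ × ℕ × ℕ) => ∀ y ∈ leafSyms x.1.2.2,
        (y.unpair.1 = 1 ∧ y.unpair.2 < x.1.2.1) ∨ (y.unpair.1 ≠ 1 ∧ HasSym x.2.1 y) :=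
      h1.forall_mem_list.comp (f := fun x : (Bool × ℕ × ℕ) × (ℕ × ℕ × ℕ) => leafSyms x.1.2.2)
        (g := fun x => (x.1.2.1, x.2.1)) (primrec_leafSyms.comp hc) (.pair hd ha)
    exact (e1.or ((e2.and e3).or (e4.and ((e5.and e6).and (e7.and e8))))).of_eq
      fun _ => Iff.rfl
  exact h2.forall_mem_list.comp (primrec_leaves.comp (.pair (.const true)
    (.pair (.const 0) (Primrec.snd.comp Primrec.snd)))) Primrec.id

theorem primrec_zeroImpOneCode : Primrec zeroImpOneCode := by
  have hvars : Primrec fun q : ℕ => Encodable.encode ((List.range q.unpair.1).map (Nat.pair 1)) :=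
    Primrec.encode.comp (Primrec.list_map (Primrec.list_range.comp primrec_unpair_fst)
      (Primrec₂.natPair.comp (.const 1) Primrec.snd))
  have hrel := fun i : ℕ => Primrec₂.natPair.comp (.const 2) (Primrec₂.natPair.comp
    primrec_unpair_fst (Primrec₂.natPair.comp (Primrec₂.natPair.comp primrec_unpair_snd (.const i))
      hvars))
  exact Primrec.nat_iterate primrec_unpair_fst (Primrec₂.natPair.comp (.const 3)
    (Primrec₂.natPair.comp (hrel 0) (hrel 1))) (Primrec₂.natPair.comp (.const 4) Primrec.snd)

theorem primrec_SCode : Primrec SCode := by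
  have hpred : Primrec predLPCode := by
    refine Primrec.listFilterMap primrec_leaves ?_
    have hc : Primrec fun x : (Bool × ℕ × ℕ) × (Bool × ℕ × ℕ) => x.2.2.2 :=
      Primrec.snd.comp (Primrec.snd.comp Primrec.snd)
    have hr := primrec_relSym.comp hc
    have hcond : PrimrecPred fun x : (Bool × ℕ × ℕ) × (Bool × ℕ × ℕ) => x.2.2.2.unpair.1 = 2 :=
      Primrec.eq.comp (primrec_unpair_fst.comp hc) (.const 2)
    have hsome := Primrec.option_some.comp (Primrec₂.natPair.comp (primrec_unpair_fst.comp hr)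
        (primrec_unpair_fst.comp (primrec_unpair_snd.comp hr)))
    exact (Primrec.ite hcond hsome (.const none)).to₂
  have hlist : Primrec fun c : ℕ => predLPCode (true, 0, c) :=
    hpred.comp (.pair (.const true) (.pair (.const 0) Primrec.id))
  have hstep : Primrec₂ fun (_ : ℕ) (x : ℕ × ℕ) => infCode (zeroImpOneCode x.1) x.2 :=
    primrec_infCode.comp (primrec_zeroImpOneCode.comp (Primrec.fst.comp Primrec.snd))
      (Primrec.snd.comp Primrec.snd)
  exact (Primrec.list_foldr hlist (.const (Nat.pair 3 (Nat.pair 0 0))) hstep).of_eq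
    fun c => by rw [SCode]

theorem primrec_renameCode : Primrec renameCode := by
  refine Primrec.nat_omega_rec' renameCode (m := id)
    (l := fun c => if c.unpair.1 = 3 then [c.unpair.2.unpair.1, c.unpair.2.unpair.2]
      else if c.unpair.1 = 4 then [c.unpair.2] else [])
    (g := fun c r => some (if c.unpair.1 = 3 then
        Nat.pair 3 (Nat.pair (r.getD 0 0) (r.getD 1 0))
      else if c.unpair.1 = 4 then Nat.pair 4 (r.getD 0 0)
      else if c.unpair.1 = 2 then
        Nat.pair 2 (Nat.pair c.unpair.2.unpair.1 (Nat.pair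
          (Nat.pair c.unpair.2.unpair.2.unpair.1.unpair.1 1) c.unpair.2.unpair.2.unpair.2))
      else c)) Primrec.id ?_ ?_ ?_ ?_
  · exact .ite (Primrec.eq.comp primrec_unpair_fst (.const 3))
      (Primrec.list_cons.comp (primrec_unpair_fst.comp primrec_unpair_snd)
        (Primrec.list_cons.comp (primrec_unpair_snd.comp primrec_unpair_snd) (.const [])))
      (.ite (Primrec.eq.comp primrec_unpair_fst (.const 4))
        (Primrec.list_cons.comp primrec_unpair_snd (.const [])) (.const []))
  · have hc : Primrec fun q : ℕ × List ℕ => q.1 := Primrec.fst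
    have htag := primrec_unpair_fst.comp hc
    have harg := primrec_unpair_snd.comp hc
    have harg' := primrec_unpair_snd.comp harg
    have hr := fun i : ℕ => (Primrec.list_getD (0 : ℕ)).comp
      (Primrec.snd : Primrec fun q : ℕ × List ℕ => q.2) (.const i)
    exact Primrec.option_some.comp (.ite (Primrec.eq.comp htag (.const 3))
      (Primrec₂.natPair.comp (.const 3) (Primrec₂.natPair.comp (hr 0) (hr 1)))
      (.ite (Primrec.eq.comp htag (.const 4)) (Primrec₂.natPair.comp (.const 4) (hr 0))
      (.ite (Primrec.eq.comp htag (.const 2))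
        (Primrec₂.natPair.comp (.const 2) (Primrec₂.natPair.comp (primrec_unpair_fst.comp harg)
          (Primrec₂.natPair.comp (Primrec₂.natPair.comp (primrec_unpair_fst.comp
            (primrec_unpair_fst.comp harg')) (.const 1)) (primrec_unpair_snd.comp harg')))) hc)))
  · intro c d hd
    split_ifs at hd with h3 h4
    · simp only [List.mem_cons, List.not_mem_nil, or_false] at hd
      rcases hd with rfl | rfl
      · exact left_lt (by omega)
      · exact right_lt (by omega)
    · simp only [List.mem_cons, List.not_mem_nil, or_false] at hd
      subst hd
      exact unpair_snd_lt (by omega)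
    · simp at hd
  · intro c
    rw [renameCode]
    split_ifs <;> simp

end LPInterpolation

namespace LPInterpolation

open Language

/-! ### Correctness of the operations on Gödel numbers -/

/-- The code of an arity and a predicate. -/
def predSym {L : FirstOrder.Language.{u, v}} [∀ k, Encodable (L.Relations k)]
    (R : Σ k, (zeroOne L).Relations k) : ℕ :=
  Nat.pair R.1 (Nat.pair (Encodable.encode (α := L.Relations R.1) R.2.1) R.2.2)

theorem predSym_injective {L : FirstOrder.Language.{u, v}} [∀ k, Encodable (L.Relations k)] :
    Function.Injective (predSym (L := L)) := by
  rintro ⟨k, p, i⟩ ⟨k', p', i'⟩ h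
  simp only [predSym, Nat.pair_eq_pair] at h
  obtain ⟨rfl, h1, h2⟩ := h
  rw [Encodable.encode_injective h1, Fin.ext h2]

section Spec

variable {L : FirstOrder.Language.{u, v}} {α : Type w} [∀ k, Encodable (L.Functions k)]
  [Encodable α]

/-- The symbol code of a free variable. -/
def varSym (a : α) : ℕ := Nat.pair 0 (Encodable.encode a)

/-- The symbol code of a function. -/
def funSym (f : Σ k, L.Functions k) : ℕ :=
  Nat.pair 2 (Nat.pair f.1 (Nat.pair (Encodable.encode f.2) f.1))

theorem termArgs_termCode {n k : ℕ} (f : (zeroOne L).Functions k)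
    (ts : Fin k → (zeroOne L).Term (α ⊕ Fin n)) :
    termArgs (termCode (.func f ts)) = List.ofFn fun i => termCode (ts i) := by
  rw [termCode, termArgs]; simp

theorem mem_termSyms_func {n k : ℕ} (f : (zeroOne L).Functions k)
    (ts : Fin k → (zeroOne L).Term (α ⊕ Fin n)) {y : ℕ} :
    y ∈ termSyms (termCode (.func f ts)) ↔
      y = funSym (L := L) ⟨k, f⟩ ∨ ∃ i, y ∈ termSyms (termCode (ts i)) := by
  rw [termSyms_eq, termArgs_termCode, termCode]
  simp [funSym, List.mem_flatten, List.mem_ofFn]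

/-- The symbols of a term code are those of the term. -/
theorem mem_termSyms [DecidableEq α] {n : ℕ} (t : (zeroOne L).Term (α ⊕ Fin n)) {y : ℕ} :
    (y ∈ termSyms (termCode t) → (y.unpair.1 = 1 ∧ y.unpair.2 < n) ∨ (y.unpair.1 ≠ 1 ∧
      ((∃ a ∈ t.varFinsetLeft, y = varSym a) ∨ ∃ f ∈ termFun t, y = funSym (L := L) f))) ∧
    (((∃ a ∈ t.varFinsetLeft, y = varSym a) ∨ ∃ f ∈ termFun t, y = funSym (L := L) f) →
      y ∈ termSyms (termCode t)) := by
  induction t with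
  | var x =>
    rcases x with a | i
    · rw [termCode, termSyms_eq]
      simp +contextual [varSym, termFun]
    · rw [termCode, termSyms_eq]
      simp +contextual [termFun]
  | func f ts ih =>
    rw [mem_termSyms_func]
    simp only [Term.varFinsetLeft, Finset.mem_biUnion, Finset.mem_univ, true_and, termFun,
      Set.singleton_union, Set.mem_insert_iff, Set.mem_iUnion]
    constructor
    · rintro (rfl | ⟨i, hi⟩)
      · exact .inr ⟨by simp [funSym], .inr ⟨_, .inl rfl, rfl⟩⟩
      · rcases (ih i).1 hi with h | ⟨h, ⟨a, ha, rfl⟩ | ⟨g, hg, rfl⟩⟩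
        · exact .inl h
        · exact .inr ⟨h, .inl ⟨a, ⟨i, ha⟩, rfl⟩⟩
        · exact .inr ⟨h, .inr ⟨g, .inr ⟨i, hg⟩, rfl⟩⟩
    · rintro (⟨a, ⟨i, ha⟩, rfl⟩ | ⟨g, rfl | ⟨i, hg⟩, rfl⟩)
      · exact .inr ⟨i, (ih i).2 (.inl ⟨a, ha, rfl⟩)⟩
      · exact .inl rfl
      · exact .inr ⟨i, (ih i).2 (.inr ⟨g, hg, rfl⟩)⟩

/-- A number whose symbols are those of the language is the code of a term. -/
theorem exists_termCode_eq {Y : ℕ → Prop}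
    (hY : ∀ y, Y y → (∃ a : α, y = varSym a) ∨ ∃ f : Σ k, L.Functions k, y = funSym f)
    {n : ℕ} (t : ℕ)
    (ht : ∀ y ∈ termSyms t, (y.unpair.1 = 1 ∧ y.unpair.2 < n) ∨ (y.unpair.1 ≠ 1 ∧ Y y)) :
    ∃ T : (zeroOne L).Term (α ⊕ Fin n), termCode T = t := by
  induction t using Nat.strong_induction_on with
  | _ t ih =>
    rw [termSyms_eq] at ht
    split_ifs at ht with h2
    · have h := ht _ List.mem_cons_self
      simp only [Nat.unpair_pair, OfNat.ofNat_ne_one, false_and, false_or, ne_eq,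
        not_false_eq_true, true_and] at h
      rcases hY _ h with ⟨a, ha⟩ | ⟨⟨k, f⟩, hf⟩
      · simp [varSym] at ha
      · simp only [funSym, Nat.pair_eq_pair, true_and] at hf
        -- `h3` concerns the claimed arity and `h5` the length of the argument list; both equal `k`.
        obtain ⟨h3, h4, h5⟩ := hf
        have hargs : ∀ i : Fin k, ∃ T : (zeroOne L).Term (α ⊕ Fin n),
            termCode T = (termArgs t).get (i.cast h5.symm) := by
          intro i
          have hi : (termArgs t).get (i.cast h5.symm) ∈ termArgs t := List.get_mem _ _
          refine ih _ (mem_termArgs_lt hi) fun y hy => ht y (List.mem_cons_of_mem _ ?_)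
          exact List.mem_flatten.2 ⟨_, List.mem_map.2 ⟨_, hi, rfl⟩, hy⟩
        choose T hT using hargs
        refine ⟨.func f T, ?_⟩
        have hl : (List.ofFn fun i => termCode (T i)) = termArgs t := by
          simp only [hT]
          refine List.ext_get (by simp [h5]) fun i h1 h2 => by simp
        rw [termCode, hl, termArgs, encode_codeList, ← h4]
        conv_rhs => rw [← Nat.pair_unpair t, h2, ← Nat.pair_unpair t.unpair.2, h3,
          ← Nat.pair_unpair t.unpair.2.unpair.2]
    · rcases ht t (by simp) with ⟨h1, h⟩ | ⟨h1, h⟩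
      · refine ⟨.var (.inr ⟨_, h⟩), ?_⟩
        rw [termCode]
        conv_rhs => rw [← Nat.pair_unpair t, h1]
      · rcases hY t h with ⟨a, rfl⟩ | ⟨f, rfl⟩
        · exact ⟨.var (.inl a), by rw [termCode, varSym]⟩
        · simp [funSym] at h2

theorem termCode_onTerm {n : ℕ} (t : (zeroOne L).Term (α ⊕ Fin n)) :
    termCode ((renameHom L).onTerm t) = termCode t := by
  induction t with
  | var => rfl
  | func f ts ih =>
    rw [LHom.onTerm, termCode, termCode]
    simp only [ih]
    rfl

variable [∀ k, Encodable (L.Relations k)]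

section Rel

variable {n k : ℕ} (R : (zeroOne L).Relations k) (ts : Fin k → (zeroOne L).Term (α ⊕ Fin n))

theorem termArgs_code_rel :
    termArgs (code (BoundedFormula.rel R ts)) = List.ofFn fun i => termCode (ts i) := by
  rw [code, termArgs]; simp

theorem relSym_code_rel : relSym (code (BoundedFormula.rel R ts)) = predSym (L := L) ⟨k, R⟩ := by
  rw [code, relSym]; simp [predSym]

theorem unpair_code_rel : (code (BoundedFormula.rel R ts)).unpair.1 = 2 := by
  rw [code]; simp

theorem leaves_code_rel (s : Bool) (m : ℕ) : leaves (s, m, code (BoundedFormula.rel R ts)) =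
    [(s, m, code (BoundedFormula.rel R ts))] :=
  leaves_of_ne (by rw [unpair_code_rel]; decide) (by rw [unpair_code_rel]; decide)

theorem mem_leafSyms_code_rel {y : ℕ} : y ∈ leafSyms (code (BoundedFormula.rel R ts)) ↔
    ∃ i, y ∈ termSyms (termCode (ts i)) := by
  rw [leafSyms, if_pos (unpair_code_rel R ts), termArgs_code_rel]
  simp

end Rel

/-- The predicates with their polarities in the leaves of a formula code. -/
theorem mem_predPolAux_iff {n : ℕ} (s : Bool) (m : ℕ) (φ : (zeroOne L).BoundedFormula α n)
    (hφ : EqFree φ) (s' : Bool) (r : ℕ) :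
    (∃ p ∈ leaves (s, m, code φ), p.1 = s' ∧ p.2.2.unpair.1 = 2 ∧ relSym p.2.2 = r) ↔
      ∃ R, (s', R) ∈ predPolAux s φ ∧ predSym (L := L) R = r := by
  induction φ generalizing s m with
  | falsum => simp [code, show Nat.pair 0 0 = 0 from rfl, leaves_zero, predPolAux]
  | equal => exact hφ.elim
  | rel R ts =>
    simp only [leaves_code_rel, List.mem_singleton, exists_eq_left, unpair_code_rel,
      relSym_code_rel, predPolAux, Set.mem_singleton_iff, Prod.mk.injEq, true_and]
    constructor
    · rintro ⟨rfl, rfl⟩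
      exact ⟨_, ⟨rfl, rfl⟩, rfl⟩
    · rintro ⟨R', ⟨rfl, rfl⟩, rfl⟩
      exact ⟨rfl, rfl⟩
  | imp f g ihf ihg =>
    rw [code, leaves_imp]
    simp only [List.mem_append, or_and_right, exists_or, ihf _ _ hφ.1, ihg _ _ hφ.2, predPolAux,
      Set.mem_union]
  | all f ih =>
    rw [code, leaves_all]
    simp only [List.mem_cons, or_and_right, exists_or, exists_eq_left, ih _ _ hφ, predPolAux]
    simp

theorem hasRel_code (φ : (zeroOne L).Formula α) (hφ : EqFree φ) (s : Bool) (r : ℕ) :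
    HasRel (code φ) s r ↔ ∃ R, (s, R) ∈ PredPol φ ∧ predSym (L := L) R = r :=
  mem_predPolAux_iff true 0 φ hφ s r

/-- The symbols in the leaves of a formula code. -/
theorem mem_syms_iff [DecidableEq α] {n : ℕ} (s : Bool) (m : ℕ)
    (φ : (zeroOne L).BoundedFormula α n) (hφ : EqFree φ) (y : ℕ) (hy : y.unpair.1 ≠ 1) :
    (∃ p ∈ leaves (s, m, code φ), y ∈ leafSyms p.2.2) ↔
      (∃ a ∈ φ.freeVarFinset, y = varSym a) ∨ ∃ f ∈ Fun φ, y = funSym (L := L) f := by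
  induction φ generalizing s m with
  | falsum =>
    simp [code, show Nat.pair 0 0 = 0 from rfl, leaves_zero, leafSyms, Fun,
      BoundedFormula.freeVarFinset]
  | equal => exact hφ.elim
  | rel R ts =>
    simp only [leaves_code_rel, List.mem_singleton, exists_eq_left, mem_leafSyms_code_rel,
      BoundedFormula.freeVarFinset, Finset.mem_biUnion, Finset.mem_univ, true_and, Fun,
      Set.mem_iUnion]
    constructor
    · rintro ⟨i, hi⟩
      rcases (mem_termSyms (ts i)).1 hi with h | ⟨-, ⟨a, ha, rfl⟩ | ⟨g, hg, rfl⟩⟩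
      · exact absurd h.1 hy
      · exact .inl ⟨a, ⟨i, ha⟩, rfl⟩
      · exact .inr ⟨g, ⟨i, hg⟩, rfl⟩
    · rintro (⟨a, ⟨i, ha⟩, rfl⟩ | ⟨g, ⟨i, hg⟩, rfl⟩)
      · exact ⟨i, (mem_termSyms (ts i)).2 (.inl ⟨a, ha, rfl⟩)⟩
      · exact ⟨i, (mem_termSyms (ts i)).2 (.inr ⟨g, hg, rfl⟩)⟩
  | imp f g ihf ihg =>
    rw [code, leaves_imp]
    simp only [List.mem_append, or_and_right, exists_or, ihf _ _ hφ.1, ihg _ _ hφ.2,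
      BoundedFormula.freeVarFinset, Finset.mem_union, Fun, Set.mem_union]
    exact or_or_or_comm
  | all f ih =>
    rw [code, leaves_all]
    simp only [List.mem_cons, or_and_right, exists_or, exists_eq_left, ih _ _ hφ,
      BoundedFormula.freeVarFinset, Fun]
    simp [leafSyms]

theorem hasSym_code [DecidableEq α] (φ : (zeroOne L).Formula α) (hφ : EqFree φ) (y : ℕ)
    (hy : y.unpair.1 ≠ 1) : HasSym (code φ) y ↔
      (∃ a ∈ φ.freeVarFinset, y = varSym a) ∨ ∃ f ∈ Fun φ, y = funSym (L := L) f :=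
  mem_syms_iff true 0 φ hφ y hy

section Leaves

variable {P : Bool → ℕ → Prop} {Y : ℕ → Prop}

/-- A formula whose leaves are well-formed is universal and over the given vocabulary. -/
theorem forall_leafOk_iff [DecidableEq α] {n : ℕ} (s : Bool) (φ : (zeroOne L).BoundedFormula α n) :
    (∀ p ∈ leaves (s, n, code φ), LeafOk P Y p) ↔
      EqFree φ ∧ univAux s φ ∧ (∀ s' R, (s', R) ∈ predPolAux s φ → P s' (predSym (L := L) R)) ∧
      (∀ a ∈ φ.freeVarFinset, Y (varSym a)) ∧ ∀ f ∈ Fun φ, Y (funSym (L := L) f) := by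
  induction φ generalizing s with
  | falsum =>
    simp [code, show Nat.pair 0 0 = 0 from rfl, leaves_zero, LeafOk, Fun, univAux, EqFree,
      BoundedFormula.freeVarFinset, predPolAux]
  | equal t t' =>
    simp only [EqFree, false_and, iff_false]
    have h : (code (BoundedFormula.equal t t')).unpair.1 = 1 := by rw [code]; simp
    rw [leaves_of_ne (by rw [h]; decide) (by rw [h]; decide)]
    simp only [List.mem_singleton, forall_eq, LeafOk, h]
    rintro (h0 | h0 | h0)
    · rw [h0] at h
      simp at h
    · simp at h0
    · simp at h0
  | @rel n k R ts =>
    have h0 : code (BoundedFormula.rel R ts) ≠ 0 := by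
      intro h
      have := unpair_code_rel R ts
      rw [h] at this
      simp at this
    have hlen : (termArgs (code (BoundedFormula.rel R ts))).length =
        (code (BoundedFormula.rel R ts)).unpair.2.unpair.1 := by
      rw [termArgs_code_rel, code]; simp
    simp only [leaves_code_rel, List.mem_singleton, forall_eq, LeafOk, h0, hlen, unpair_code_rel,
      relSym_code_rel, mem_leafSyms_code_rel, EqFree, univAux, predPolAux, Set.mem_singleton_iff,
      Prod.mk.injEq, BoundedFormula.freeVarFinset, Finset.mem_biUnion, Finset.mem_univ, true_and,
      Fun, Set.mem_iUnion, false_or, Nat.reduceEqDiff, false_and,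
      forall_exists_index, and_imp]
    constructor
    · rintro ⟨h1, h2⟩
      refine ⟨?_, fun a i ha => ?_, fun f i hf => ?_⟩
      · rintro s' R' rfl rfl
        exact h1
      · have := h2 _ i ((mem_termSyms (ts i)).2 (.inl ⟨a, ha, rfl⟩))
        simpa [varSym] using this
      · have := h2 _ i ((mem_termSyms (ts i)).2 (.inr ⟨f, hf, rfl⟩))
        simpa [funSym] using this
    · rintro ⟨h1, h2, h3⟩
      refine ⟨h1 _ _ rfl rfl, fun y i hy => ?_⟩
      rcases (mem_termSyms (ts i)).1 hy with h | ⟨h, ⟨a, ha, rfl⟩ | ⟨g, hg, rfl⟩⟩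
      · exact .inl h
      · exact .inr ⟨h, h2 a i ha⟩
      · exact .inr ⟨h, h3 g i hg⟩
  | imp f g ihf ihg =>
    rw [code, leaves_imp]
    simp only [List.forall_mem_append, ihf, ihg, EqFree, univAux, predPolAux, Set.mem_union,
      BoundedFormula.freeVarFinset, Finset.mem_union, Fun, or_imp, forall_and]
    tauto
  | @all n f ih =>
    rw [code, leaves_all]
    simp only [List.forall_mem_cons, ih, EqFree, univAux, predPolAux,
      BoundedFormula.freeVarFinset, Fun]
    have h : LeafOk P Y (s, n, Nat.pair 4 (code f)) ↔ s = true := by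
      simp only [LeafOk, Nat.unpair_pair, true_and, Nat.reduceEqDiff,
        false_and, or_false]
      refine or_iff_right fun h => ?_
      have := congrArg (fun c => c.unpair.1) h
      simp at this
    rw [h]
    tauto

/-- A number whose leaves are well-formed over the vocabulary of the language is the code of a
formula. -/
theorem exists_code_eq
    (hP : ∀ s r, P s r → ∃ R, predSym (L := L) R = r)
    (hY : ∀ y, y.unpair.1 ≠ 1 → Y y →
      (∃ a : α, y = varSym a) ∨ ∃ f : Σ k, L.Functions k, y = funSym f)
    {n : ℕ} (s : Bool) (c : ℕ) (hc : ∀ p ∈ leaves (s, n, c), LeafOk P Y p) :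
    ∃ φ : (zeroOne L).BoundedFormula α n, code φ = c := by
  induction c using Nat.strong_induction_on generalizing s n with
  | _ c ih =>
    by_cases h3 : c.unpair.1 = 3
    · have hcc : c = Nat.pair 3 (Nat.pair c.unpair.2.unpair.1 c.unpair.2.unpair.2) := by
        rw [Nat.pair_unpair, ← h3, Nat.pair_unpair]
      rw [hcc, leaves_imp, List.forall_mem_append] at hc
      obtain ⟨f, hf⟩ := ih _ (left_lt (by omega)) _ hc.1
      obtain ⟨g, hg⟩ := ih _ (right_lt (by omega)) _ hc.2
      exact ⟨f.imp g, by rw [code, hf, hg, ← hcc]⟩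
    by_cases h4 : c.unpair.1 = 4
    · have hcc : c = Nat.pair 4 c.unpair.2 := by rw [← h4, Nat.pair_unpair]
      rw [hcc, leaves_all, List.forall_mem_cons] at hc
      obtain ⟨f, hf⟩ := ih _ (unpair_snd_lt (by omega)) _ hc.2
      exact ⟨f.all, by rw [code, hf, ← hcc]⟩
    rw [leaves_of_ne h3 h4] at hc
    simp only [List.mem_singleton, forall_eq, LeafOk] at hc
    rcases hc with rfl | ⟨h, -⟩ | ⟨h2, hR, hlen, hsyms⟩
    · exact ⟨.falsum, rfl⟩
    · exact absurd h h4
    · obtain ⟨⟨k, R⟩, hR⟩ := hP _ _ hR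
      simp only [predSym, relSym, Nat.pair_eq_pair] at hR
      obtain ⟨hk, hR⟩ := hR
      rw [← hk] at hlen
      rw [leafSyms, if_pos h2] at hsyms
      have hargs : ∀ i : Fin k, ∃ T : (zeroOne L).Term (α ⊕ Fin n),
          termCode T = (termArgs c).get (i.cast hlen.symm) := by
        intro i
        refine exists_termCode_eq (Y := fun y => y.unpair.1 ≠ 1 ∧ Y y)
          (fun y hy => hY y hy.1 hy.2) _ fun y hy => ?_
        have := hsyms y (List.mem_flatMap.2 ⟨_, List.get_mem _ _, hy⟩)
        tauto
      choose T hT using hargs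
      have hl : (List.ofFn fun i => termCode (T i)) = termArgs c := by
        simp only [hT]
        refine List.ext_get (by simp [hlen]) fun i h1 h2 => by simp
      refine ⟨BoundedFormula.rel R T, ?_⟩
      rw [code, hl, termArgs, encode_codeList, hR]
      conv_rhs => rw [← Nat.pair_unpair c, h2, ← Nat.pair_unpair c.unpair.2, ← hk,
        ← Nat.pair_unpair c.unpair.2.unpair.2]

end Leaves

theorem code_inf (f g : (zeroOne L).Formula α) : code (f ⊓ g) = infCode (code f) (code g) := rfl

theorem predLPCode_code {n : ℕ} (s : Bool) (m : ℕ) (φ : (zeroOne L).BoundedFormula α n)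
    (hφ : EqFree φ) : predLPCode (s, m, code φ) =
      (predLP φ).map fun p => Nat.pair p.1 (Encodable.encode p.2) := by
  induction φ generalizing s m with
  | falsum => simp [code, show Nat.pair 0 0 = 0 from rfl, predLPCode, leaves_zero, predLP]
  | equal => exact hφ.elim
  | rel R ts =>
    rw [predLPCode, leaves_code_rel]
    simp [unpair_code_rel, relSym_code_rel, predSym, predLP]
  | imp f g ihf ihg =>
    have h1 := ihf (!s) m hφ.1
    have h2 := ihg s m hφ.2
    rw [predLPCode] at h1 h2 ⊢
    rw [code, leaves_imp, List.filterMap_append, h1, h2, predLP, List.map_append]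
  | all f ih =>
    have h1 := ih s (m + 1) hφ
    rw [predLPCode] at h1 ⊢
    rw [code, leaves_all, List.filterMap_cons, h1, predLP]
    simp

theorem code_alls {n : ℕ} (φ : (zeroOne L).BoundedFormula α n) :
    code φ.alls = (Nat.pair 4)^[n] (code φ) := by
  induction n with
  | zero => rfl
  | succ n ih => exact ih φ.all

theorem code_zeroImpOne (p : Σ k, L.Relations k) : code (zeroImpOne p : (zeroOne L).Formula α) =
    zeroImpOneCode (Nat.pair p.1 (Encodable.encode p.2)) := by
  have h : (List.ofFn fun i : Fin p.1 => Nat.pair 1 (i : ℕ)) =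
      (List.range p.1).map (Nat.pair 1) :=
    List.ext_getElem (by simp) fun i h1 h2 => by simp
  rw [zeroImpOne, code_alls, zeroImpOneCode]
  simp only [code, Relations.boundedFormula, termCode, Nat.unpair_pair, h]
  rfl

theorem code_S (F : (zeroOne L).Formula α) (hF : EqFree F) : code (S F) = SCode (code F) := by
  rw [SCode, predLPCode_code true 0 F hF, List.foldr_map, S]
  induction predLP F with
  | nil => rfl
  | cons p l ih => rw [List.foldr_cons, List.foldr_cons, ← ih, code_inf, code_zeroImpOne]

theorem code_rename {n : ℕ} (φ : (zeroOne L).BoundedFormula α n) (hφ : EqFree φ) :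
    code ((renameHom L).onBoundedFormula φ) = renameCode (code φ) := by
  induction φ with
  | falsum => rw [code, show Nat.pair 0 0 = 0 from rfl, renameCode]; simp; rfl
  | equal => exact hφ.elim
  | rel R ts =>
    rw [code, renameCode]
    simp only [LHom.onBoundedFormula, Relations.boundedFormula, code, Function.comp_apply,
      termCode_onTerm]
    simp [renameHom]
  | imp f g ihf ihg =>
    rw [LHom.onBoundedFormula, code, ihf hφ.1, ihg hφ.2, code, renameCode.eq_def (Nat.pair 3 _)]
    simp
  | all f ih =>
    rw [LHom.onBoundedFormula, code, ih hφ, code, renameCode.eq_def (Nat.pair 4 _)]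
    simp

end Spec

end LPInterpolation

namespace LPInterpolation

open Language

/-! ### The search for a Craig-Lyndon interpolant -/

section Search

variable {L : FirstOrder.Language.{u, v}} {α : Type w} [DecidableEq α]
    [∀ k, Encodable (L.Functions k)] [∀ k, Encodable (L.Relations k)] [Encodable α]

/-- Universality and the conditions on vocabulary and free variables can be read off the leaves,
since distinct symbols have distinct codes. -/
theorem admissible_code_iff {A B H : (zeroOne L).Formula α} (hA : EqFree A) (hB : EqFree B) :
    Admissible (code A) (code B) (code H) ↔ EqFree H ∧ Universal H ∧
      PredPol H ⊆ PredPol A ∩ PredPol B ∧ H.freeVarFinset ⊆ A.freeVarFinset ∧ Fun H ⊆ Fun A := by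
  rw [Admissible, forall_leafOk_iff]
  refine and_congr_right fun _ => and_congr_right fun _ => and_congr ?_ (and_congr ?_ ?_)
  · have h : ∀ {C : (zeroOne L).Formula α}, EqFree C → ∀ s R,
        HasRel (code C) s (predSym (L := L) R) ↔ (s, R) ∈ PredPol C := fun hC s R => by
      rw [hasRel_code _ hC]
      exact ⟨fun ⟨R', h1, h2⟩ => predSym_injective h2 ▸ h1, fun h1 => ⟨R, h1, rfl⟩⟩
    simp only [h hA, h hB]
    exact ⟨fun h' p hp => h' p.1 p.2 hp, fun h' s R hp => h' hp⟩
  · refine forall₂_congr fun a _ => ?_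
    rw [hasSym_code A hA _ (by simp [varSym])]
    constructor
    · rintro (⟨a', ha, h⟩ | ⟨f, -, h⟩)
      · simp only [varSym, Nat.pair_eq_pair, true_and] at h
        rwa [Encodable.encode_injective h]
      · simp [varSym, funSym] at h
    · exact fun ha => .inl ⟨a, ha, rfl⟩
  · refine forall₂_congr fun f _ => ?_
    rw [hasSym_code A hA _ (by simp [funSym])]
    constructor
    · rintro (⟨a', ha, h⟩ | ⟨⟨k, g⟩, hg, h⟩)
      · simp [varSym, funSym] at h
      · obtain ⟨l, f⟩ := f
        simp only [funSym, Nat.pair_eq_pair, true_and] at h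
        obtain ⟨rfl, h, -⟩ := h
        rwa [Encodable.encode_injective h]
    · exact fun hf => .inr ⟨f, hf, rfl⟩

/-- Lets the search run over all numbers: a number that passes the test uses only symbols of A and
can therefore be decoded. -/
theorem exists_code_eq_of_admissible {A B : (zeroOne L).Formula α} (hA : EqFree A) {c : ℕ}
    (h : Admissible (code A) (code B) c) : ∃ H : (zeroOne L).Formula α, code H = c := by
  refine exists_code_eq (fun s r hr => ?_) (fun y hy hY => ?_) true c h
  · obtain ⟨R, -, hR⟩ := (hasRel_code A hA s r).1 hr.1
    exact ⟨R, hR⟩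
  · rcases (hasSym_code A hA y hy).1 hY with ⟨a, -, rfl⟩ | ⟨f, -, rfl⟩
    · exact .inl ⟨a, rfl⟩
    · exact .inr ⟨f, rfl⟩

end Search

/-- `n` consists of the code of a universal Craig-Lyndon interpolant of the formulas with codes `a`
and `b` and of certificates for the two entailments. -/
def InterpolantCert (a b n : ℕ) : Prop :=
  Admissible a b n.unpair.1 ∧
    UnsatCert (henkinClause (Nat.pair 3 (Nat.pair a n.unpair.1))) n.unpair.2.unpair.1 ∧
    UnsatCert (henkinClause (Nat.pair 3 (Nat.pair n.unpair.1 b))) n.unpair.2.unpair.2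

theorem primrecPred_interpolantCert :
    PrimrecPred fun q : ℕ × ℕ × ℕ => InterpolantCert q.1 q.2.1 q.2.2 := by
  have ha : Primrec fun q : ℕ × ℕ × ℕ => q.1 := Primrec.fst
  have hb : Primrec fun q : ℕ × ℕ × ℕ => q.2.1 := Primrec.fst.comp Primrec.snd
  have hn : Primrec fun q : ℕ × ℕ × ℕ => q.2.2 := Primrec.snd.comp Primrec.snd
  have hh := primrec_unpair_fst.comp hn
  have hr := primrec_unpair_snd.comp hn
  have hcert := primrecPred_unsatCert primrec_henkinClause
  have hcert' : ∀ {f g : ℕ × ℕ × ℕ → ℕ}, Primrec f → Primrec g →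
      PrimrecPred fun q => UnsatCert (henkinClause (f q)) (g q) :=
    fun hf hg => hcert.comp (hf.pair hg)
  have himp : ∀ {f g : ℕ × ℕ × ℕ → ℕ}, Primrec f → Primrec g →
      Primrec fun q => Nat.pair 3 (Nat.pair (f q) (g q)) :=
    fun hf hg => Primrec₂.natPair.comp (.const 3) (Primrec₂.natPair.comp hf hg)
  have h1 : PrimrecPred fun q : ℕ × ℕ × ℕ => Admissible q.1 q.2.1 q.2.2.unpair.1 :=
    primrecPred_admissible.comp (ha.pair (hb.pair hh))
  exact h1.and ((hcert' (himp ha hh) (primrec_unpair_fst.comp hr)).and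
    (hcert' (himp hh hb) (primrec_unpair_snd.comp hr)))

section Search

variable {L : FirstOrder.Language.{u, v}} {α : Type w} [DecidableEq α]
    [∀ k, Encodable (L.Functions k)] [∀ k, Encodable (L.Relations k)] [Encodable α]

theorem InterpolantCert.exists_interpolant {A B : (zeroOne L).Formula α} (hA : EqFree A)
    (hB : EqFree B) (hfun : Fun A ⊆ Fun B) {n : ℕ} (h : InterpolantCert (code A) (code B) n) :
    ∃ H, code H = n.unpair.1 ∧ Universal H ∧ IsCraigLyndonInterpolant A B H ∧
      H.freeVarFinset ⊆ A.freeVarFinset := by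
  obtain ⟨h1, h2, h3⟩ := h
  obtain ⟨H, hH⟩ := exists_code_eq_of_admissible hA h1
  rw [← hH] at h1 h2 h3
  obtain ⟨h4, h5, h6, h7, h8⟩ := (admissible_code_iff hA hB).1 h1
  exact ⟨H, hH, h5, ⟨h4, (entails_iff_exists_unsatCert hA h4).2 ⟨_, h2⟩,
    (entails_iff_exists_unsatCert h4 hB).2 ⟨_, h3⟩, h6,
    fun f hf => ⟨h8 hf, hfun (h8 hf)⟩⟩, h7⟩

/-- Termination of the search: the interpolant from the nonconstructive existence theorem has a
code, and both of its entailments have finite certificates. -/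
theorem exists_interpolantCert {A B : (zeroOne L).Formula α} (hA : EqFree A)
    (hB : EqFree B) (hU : Universal A) (hfun : Fun A ⊆ Fun B) (h : Entails A B) :
    ∃ n, InterpolantCert (code A) (code B) n := by
  obtain ⟨H, h1, h2, h3⟩ := exists_universal_interpolant hA hB hU hfun h
  obtain ⟨N, hN⟩ := (entails_iff_exists_unsatCert hA h2.eqFree).1 h2.left
  obtain ⟨K, hK⟩ := (entails_iff_exists_unsatCert h2.eqFree hB).1 h2.right
  refine ⟨Nat.pair (code H) (Nat.pair N K), ?_⟩
  simp only [InterpolantCert, Nat.unpair_pair]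
  exact ⟨(admissible_code_iff hA hB).2 ⟨h2.eqFree, h1, h2.predPol, h3,
    h2.func.trans Set.inter_subset_left⟩, hN, hK⟩

end Search

open Classical in
/-- One step of the search for an LP-interpolant of the formulas with codes `p.1` and `p.2`. -/
noncomputable def searchStep (p : ℕ × ℕ) (n : ℕ) : Option ℕ :=
  if InterpolantCert (infCode (SCode p.1) p.1) (Nat.pair 3 (Nat.pair (SCode p.2) p.2)) n then
    some (infCode n.unpair.1 (renameCode n.unpair.1)) else none

open Classical in
theorem primrec_searchStep : Primrec₂ searchStep := by
  have hF : Primrec fun q : (ℕ × ℕ) × ℕ => q.1.1 := Primrec.fst.comp Primrec.fst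
  have hG : Primrec fun q : (ℕ × ℕ) × ℕ => q.1.2 := Primrec.snd.comp Primrec.fst
  have hn : Primrec fun q : (ℕ × ℕ) × ℕ => q.2.unpair.1 := primrec_unpair_fst.comp Primrec.snd
  have ha := primrec_infCode.comp (primrec_SCode.comp hF) hF
  have hb := Primrec₂.natPair.comp (.const 3) (Primrec₂.natPair.comp (primrec_SCode.comp hG) hG)
  have hcond : PrimrecPred fun q : (ℕ × ℕ) × ℕ => InterpolantCert (infCode (SCode q.1.1) q.1.1)
      (Nat.pair 3 (Nat.pair (SCode q.1.2) q.1.2)) q.2 :=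
    primrecPred_interpolantCert.comp (ha.pair (hb.pair Primrec.snd))
  exact Primrec.ite hcond (Primrec.option_some.comp (primrec_infCode.comp hn
    (primrec_renameCode.comp hn))) (.const none)

end LPInterpolation

/-! ### Search for the LP-interpolant and its correctness -/

theorem mainTheorem3 {L : FirstOrder.Language.{u, v}} {α : Type w} [DecidableEq α]
    [∀ k, Encodable (L.Functions k)] [∀ k, Encodable (L.Relations k)] [Encodable α] :
    ∃ f : ℕ → ℕ →. ℕ, Partrec₂ f ∧
      ∀ F G : (zeroOne L).Formula α, EqFree F → EqFree G →
        EncodesLP F → Fun F ⊆ Fun G → Entails (S F ⊓ F) ((S G).imp G) →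
        (∃ H' : (zeroOne L).Formula α,
          Universal H' ∧
          IsCraigLyndonInterpolant (S F ⊓ F) ((S G).imp G) H' ∧
          H'.freeVarFinset ⊆ F.freeVarFinset ∧
          IsLPInterpolant F G (H' ⊓ rename01 H') ∧
          code (H' ⊓ rename01 H') ∈ f (code F) (code G)) ∧
        ∀ H' : (zeroOne L).Formula α, Universal H' →
          IsCraigLyndonInterpolant (S F ⊓ F) ((S G).imp G) H' →
          IsLPInterpolant F G (H' ⊓ rename01 H') := by
  -- The search acts on plain numbers, so it is independent of the two formulas and even of the
  -- signature.
  refine ⟨fun F G => Nat.rfindOpt (searchStep (F, G)), Partrec.rfindOpt primrec_searchStep.to_comp,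
    fun F G hF hG hLP hfun hFG => ⟨?_, fun H hH h => isLPInterpolant_inf_rename01 hLP hH h⟩⟩
  have hA : EqFree (S F ⊓ F) := eqFree_inf.2 ⟨eqFree_S F, hF⟩
  have hB : EqFree ((S G).imp G) := ⟨eqFree_S G, hG⟩
  have hU : Universal (S F ⊓ F) := univAux_inf.2 ⟨univAux_S F, hLP.1⟩
  -- The axioms p⁰ → p¹ contain no functions, so the hypothesis on `F` and `G` carries over.
  have hfun' : Fun (S F ⊓ F) ⊆ Fun ((S G).imp G) := by
    rw [fun_inf, fun_S, Set.empty_union]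
    exact hfun.trans Set.subset_union_right
  have hcA : infCode (SCode (code F)) (code F) = code (S F ⊓ F) := by rw [code_inf, code_S F hF]
  have hcB : Nat.pair 3 (Nat.pair (SCode (code G)) (code G)) = code ((S G).imp G) := by
    rw [code, code_S G hG]
  have hdom : (Nat.rfindOpt (searchStep (code F, code G))).Dom := by
    obtain ⟨n, hn⟩ := exists_interpolantCert hA hB hU hfun' hFG
    refine Nat.rfindOpt_dom.2 ⟨n, infCode n.unpair.1 (renameCode n.unpair.1), ?_⟩
    rw [searchStep, if_pos (by rw [hcA, hcB]; exact hn)]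
    rfl
  obtain ⟨c, hc⟩ := Part.dom_iff_mem.1 hdom
  obtain ⟨n, hn⟩ := Nat.rfindOpt_spec hc
  rw [searchStep] at hn
  split_ifs at hn with hcert
  · rw [hcA, hcB] at hcert
    obtain ⟨H, h1, h2, h3, h4⟩ := hcert.exists_interpolant hA hB hfun'
    refine ⟨H, h2, h3, ?_, isLPInterpolant_inf_rename01 hLP h2 h3, ?_⟩
    -- `S F` is a sentence, so the free variables of A are those of `F`.
    · rwa [freeVarFinset_inf, freeVarFinset_S, Finset.empty_union] at h4
    · rw [code_inf, rename01, Language.LHom.onFormula, code_rename H h3.eqFree, h1]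
      rw [Option.mem_some_iff.1 hn]
      exact hc
  · simp at hn
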